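/- Setting. $N\ge 1$ agents communicate over directed graphs $(\mathcal V,\mathcal E_t)$, $\mathcal V=\{1,\dots,N\}$, $t\ge1$, where $(i,j)\in\mathcal E_t$ means that $i$ receives messages from $j$ at time $t$, with weight matrices $W_t$. For some $w\in(0,1)$ and some integer $B\ge1$: $[W_t]_{ij}\ge w$ if $(i,j)\in\mathcal E_t$ or $j=i$, and $[W_t]_{ij}=0$ otherwise; $W_t$ is doubly stochastic; and the graph with edge set $\bigcup_{l=0}^{B-1}\mathcal E_{t+l}$ is strongly connected for every $t\ge1$. Agent $i$ has (not necessarily convex) differentiable cost functions $f_{i,t}:\mathbb R^d\to\mathbb R$, $1\le t\le T$, with $L$-Lipschitz gradients; put $f_t=\sum_{i=1}^N f_{i,t}$. The agents have access to random maps $\widehat\nabla f_{i,t}:\mathbb R^d\to\mathbb R^d$. From initial states $x_{i,1}$ (deterministic or random) they run $$x_{i,t+1}=\sum_{j=1}^N[W_t]_{ij}x_{j,t}-\eta_t\,\mathrm{clip}_{\lambda_t}\big(\widehat\nabla f_{i,t}(x_{i,t})\big),\qquad \mathrm{clip}_\lambda(y)=\min\{1,\lambda/\|y\|\}\,y .$$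 Let $\mathcal F_t$ be the $\sigma$-algebra generated by the initial states and by $\widehat\nabla f_{j,s}(x_{j,s})$, $1\le j\le N$, $1\le s<t$. Assume that for some $\sigma>0$, $p\in(1,2]$, $B_X>0$, $B_g>0$ and all $1\le i\le N$, $1\le t\le T$, almost surely $$\mathbb E\big[\widehat\nabla f_{i,t}(x_{i,t})\,\big|\,\mathcal F_t\big]=\nabla f_{i,t}(x_{i,t}),\qquad \mathbb E\big[\|\widehat\nabla f_{i,t}(x_{i,t})-\nabla f_{i,t}(x_{i,t})\|^p\,\big|\,\mathcal F_t\big]\le\sigma^p,$$ $$\|x_{i,t}\|\le B_X,\qquad \|\nabla f_{i,t}(x_{i,t})\|\le B_g,\qquad \|\nabla f_{i,t}(\bar x_t)\|\le B_g,\qquad \bar x_t=\tfrac1N\sum_{j=1}^N x_{j,t}.$$ Let $$\mathbf{NREG}_T^d=\sum_{t=1}^T\sum_{i=1}^N\|\nabla f_t(x_{i,t})\|^2,\qquad D_T=\sum_{t=2}^T\sup_{x\in\mathbb R^d}|f_t(x)-f_{t-1}(x)|,$$ with $D_T$ finite. Corollary 2. Let $\lambda_t=2B_g t^{\alpha}$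 and $\eta_t=(at+b)^{-\kappa}$ with $\kappa=\frac{p+1}{2p}$, $\alpha=\frac1{2p}$, $a>0$ and $a+b>0$. Then there is a constant $C>0$, depending only on $N,p,\sigma,L,B_X,B_g,w,B,a,b$, such that for all $T\ge1$ and all $\delta\in(0,1)$, with probability at least $1-\delta$, $$\mathbf{NREG}_T^d\le C\,T^{\frac{1+p}{2p}}\Big(1+D_T+\log\frac1\delta\Big).$$ -/

import Mathlib

open MeasureTheory ProbabilityTheory
open scoped BigOperators NNReal

noncomputable section

namespace ODCSGD

/-- The decision space `ℝ^d` with its Euclidean norm. -/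
abbrev Vec (d : ℕ) : Type := EuclideanSpace ℝ (Fin d)

/-! ### Communication network -/

/-- The directed graph on the agents with edge relation `R` is strongly connected: any agent is
joined to any other one by a directed path. -/
def StronglyConnected {N : ℕ} (R : Fin N → Fin N → Prop) : Prop :=
  ∀ i j, Relation.ReflTransGen R i j

/-- The union of the edge sets at the times `t, …, t + B - 1`. -/
def unionEdges {N : ℕ} (edge : ℕ → Fin N → Fin N → Prop) (B t : ℕ) : Fin N → Fin N → Prop :=
  fun i j => ∃ l < B, edge (t + l) i j

/-- The assumption on the weighted graphs `(V, W t, edge t)`, `t ≥ 1`; `edge t i j` means that `i`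
receives messages from `j` at time `t`, and the in-neighbours of `i` are these `j` and `i` itself. -/
structure NetworkAssumption {N : ℕ} (w : ℝ) (B : ℕ) (edge : ℕ → Fin N → Fin N → Prop)
    (W : ℕ → Matrix (Fin N) (Fin N) ℝ) : Prop where
  weight_ge : ∀ t, 1 ≤ t → ∀ i j, (edge t i j ∨ j = i) → w ≤ W t i j
  weight_eq_zero : ∀ t, 1 ≤ t → ∀ i j, ¬ (edge t i j ∨ j = i) → W t i j = 0
  row_sum : ∀ t, 1 ≤ t → ∀ i, ∑ j, W t i j = 1
  col_sum : ∀ t, 1 ≤ t → ∀ j, ∑ i, W t i j = 1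
  connected : ∀ t, 1 ≤ t → StronglyConnected (unionEdges edge B t)

/-! ### The algorithm -/

/-- The clipping operator `y ↦ min {1, lam / ‖y‖} y`. -/
def clip {d : ℕ} (lam : ℝ) (y : Vec d) : Vec d := min 1 (lam / ‖y‖) • y

/-- The step size `1 / (a t + b) ^ κ`. -/
def stepSize (a b κ : ℝ) (t : ℕ) : ℝ := 1 / (a * t + b) ^ κ

/-- The clipping level `2 B_g t ^ α`. -/
def clipLevel (Bg α : ℝ) (t : ℕ) : ℝ := 2 * Bg * (t : ℝ) ^ α

/-- The states `x_{i,t}` of the agents for `t ≥ 1`, started at `x₁`, when `g i t` is the gradient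
estimator of agent `i` at time `t`:
`x_{i,t+1} = ∑ j, (W t) i j • x_{j,t} - η t • clip (lam t) (g i t (x_{i,t}))`.
The time index `0` is not used by the algorithm. -/
def states {N d : ℕ} (W : ℕ → Matrix (Fin N) (Fin N) ℝ) (η lam : ℕ → ℝ)
    (x₁ : Fin N → Vec d) (g : Fin N → ℕ → Vec d → Vec d) : ℕ → Fin N → Vec d
  | 0 => x₁
  | 1 => x₁
  | t + 2 => fun i =>
      ∑ j, W (t + 1) i j • states W η lam x₁ g (t + 1) j
        - η (t + 1) • clip (lam (t + 1)) (g i (t + 1) (states W η lam x₁ g (t + 1) i))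

/-- The average of the states. -/
def average {N d : ℕ} (x : Fin N → Vec d) : Vec d := (N : ℝ)⁻¹ • ∑ i, x i

/-- The random states `x_{i,t}`, for random initial states and random gradient estimators. -/
def randomStates {N d : ℕ} {Ω : Type*} (W : ℕ → Matrix (Fin N) (Fin N) ℝ) (η lam : ℕ → ℝ)
    (x₁ : Fin N → Ω → Vec d) (g : Fin N → ℕ → Ω → Vec d → Vec d) (t : ℕ) (i : Fin N) (ω : Ω) :
    Vec d :=
  states W η lam (fun j => x₁ j ω) (fun j s => g j s ω) t i

/-- The noisy gradient that agent `i` observes at time `t`: its estimator at its own state. -/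
def observed {N d : ℕ} {Ω : Type*} (g : Fin N → ℕ → Ω → Vec d → Vec d)
    (X : ℕ → Fin N → Ω → Vec d) (i : Fin N) (t : ℕ) (ω : Ω) : Vec d :=
  g i t ω (X t i ω)

/-- The information available before the gradients of time `t` are observed: the σ-algebra
generated by the initial states and the noisy gradients observed by all agents at the times
`1, …, t - 1`. -/
@[reducible] def history {N d : ℕ} {Ω : Type*} (x₁ : Fin N → Ω → Vec d) (G : Fin N → ℕ → Ω → Vec d) (t : ℕ) :
    MeasurableSpace Ω :=
  (⨆ j, MeasurableSpace.comap (x₁ j) inferInstance) ⊔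
    ⨆ s ∈ Finset.Ico 1 t, ⨆ j, MeasurableSpace.comap (G j s) inferInstance

/-! ### Assumptions on the cost functions and the gradient estimators -/

/-- `f` is `L`-smooth. -/
def LSmooth {d : ℕ} (L : ℝ≥0) (f : Vec d → ℝ) : Prop :=
  Differentiable ℝ f ∧ LipschitzWith L (gradient f)

/-- Given the past, the observed gradients are unbiased up to time `T`. -/
def Unbiased {N d : ℕ} {Ω : Type*} [MeasurableSpace Ω] (μ : Measure Ω) (T : ℕ)
    (f : Fin N → ℕ → Vec d → ℝ) (x₁ : Fin N → Ω → Vec d) (X : ℕ → Fin N → Ω → Vec d)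
    (G : Fin N → ℕ → Ω → Vec d) : Prop :=
  ∀ t ∈ Finset.Icc 1 T, ∀ i,
    Integrable (G i t) μ ∧
    μ[G i t | history x₁ G t] =ᵐ[μ] fun ω => gradient (f i t) (X t i ω)

/-- Given the past, the noise in the observed gradients has a `p`-th moment of at most `σ ^ p`, up
to time `T`. -/
def HeavyTailed {N d : ℕ} {Ω : Type*} [MeasurableSpace Ω] (μ : Measure Ω) (T : ℕ) (p σ : ℝ)
    (f : Fin N → ℕ → Vec d → ℝ) (x₁ : Fin N → Ω → Vec d) (X : ℕ → Fin N → Ω → Vec d)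
    (G : Fin N → ℕ → Ω → Vec d) : Prop :=
  ∀ t ∈ Finset.Icc 1 T, ∀ i,
    Integrable (fun ω => ‖G i t ω - gradient (f i t) (X t i ω)‖ ^ p) μ ∧
    μ[fun ω => ‖G i t ω - gradient (f i t) (X t i ω)‖ ^ p | history x₁ G t]
      ≤ᵐ[μ] fun _ => σ ^ p

/-- Almost surely, up to time `T`, the states are bounded by `BX`, and the local gradients at the
states and at their averages are bounded by `Bg`. -/
def BoundedStates {N d : ℕ} {Ω : Type*} [MeasurableSpace Ω] (μ : Measure Ω) (T : ℕ) (BX Bg : ℝ)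
    (f : Fin N → ℕ → Vec d → ℝ) (X : ℕ → Fin N → Ω → Vec d) : Prop :=
  ∀ᵐ ω ∂μ, ∀ t ∈ Finset.Icc 1 T, ∀ i,
    ‖X t i ω‖ ≤ BX ∧ ‖gradient (f i t) (X t i ω)‖ ≤ Bg ∧
      ‖gradient (f i t) (average fun j => X t j ω)‖ ≤ Bg

/-! ### Regret and variation -/

/-- The global cost `f_t = ∑ i, f_{i,t}`. -/
def globalCost {N d : ℕ} (f : Fin N → ℕ → Vec d → ℝ) (t : ℕ) (x : Vec d) : ℝ := ∑ i, f i t x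

/-- The dynamic regret `∑_{t=1}^T ∑_{i=1}^N ‖∇ f_t (x_{i,t})‖ ^ 2`. -/
def nreg {N d : ℕ} (f : Fin N → ℕ → Vec d → ℝ) (x : ℕ → Fin N → Vec d) (T : ℕ) : ℝ :=
  ∑ t ∈ Finset.Icc 1 T, ∑ i, ‖gradient (globalCost f t) (x t i)‖ ^ 2

/-- `‖f_t - f_{t-1}‖_sup` is finite for `2 ≤ t ≤ T`. -/
def FiniteVariation {N d : ℕ} (f : Fin N → ℕ → Vec d → ℝ) (T : ℕ) : Prop :=
  ∀ t ∈ Finset.Icc 2 T, BddAbove (Set.range fun x => |globalCost f t x - globalCost f (t - 1) x|)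

/-- The variation `D_T = ∑_{t=2}^T ‖f_t - f_{t-1}‖_sup`. -/
def variation {N d : ℕ} (f : Fin N → ℕ → Vec d → ℝ) (T : ℕ) : ℝ :=
  ∑ t ∈ Finset.Icc 2 T, ⨆ x, |globalCost f t x - globalCost f (t - 1) x|

end ODCSGD

end

noncomputable section

namespace ODCSGD

/-!
Write `x̄ t` for the average of the states and `F t` for the global cost, and put
`κ = (p + 1) / (2p)` and `α = 1 / (2p)`, so that `2α = 2κ - 1` and `α (1 - p) = κ - 1`.

*Consensus.* Within `B` steps the set of agents reached by the message of a given agent grows, so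
products of `N B` consecutive weight matrices have all entries at least `w ^ (N B)` and contract
the disagreement by the factor `1 - w ^ (N B)`. Since one step perturbs the averaging by at most
`η t * lam t`, the accumulated disagreement is `O(1 + ∑ η t * lam t) = O(T ^ κ)`.

*Descent.* As the weights are doubly stochastic, `x̄` moves by `-η t` times the mean clipped
gradient. Dividing the descent inequality of `F t` by `η t` and summing by parts bounds
`∑ ‖∇ F t (x̄ t)‖ ^ 2` by `O((η T)⁻¹ (1 + D_T) + ∑ η t * lam t ^ 2 + T ^ κ) = O(T ^ κ (1 + D_T))`
plus a multiple of the summed clipping errors. The terms `‖∇ F t (x i)‖ ^ 2` differ from these by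
the disagreement.

*Noise.* Because `‖∇ f i t‖ ≤ Bg ≤ lam t / 2`, clipping changes an observation only if its noise
is at least `lam t / 2`, and the `p`-th moment bounds the resulting conditional bias by a multiple
of `(lam t / 2) ^ (1 - p) = O(t ^ (κ - 1))`. The clipping errors themselves are `O(t ^ α)`, so
their squares sum to `O(T ^ (2κ))`. The exponential moment with parameter of order `T ^ (-κ)` then
bounds their sum by `O(T ^ κ (1 + log (1 / δ)))` outside an event of probability `δ`.
-/

/-! ### Averaging with row-stochastic matrices -/

section Disagreement

variable {ι E : Type*} [NormedAddCommGroup E]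

/-- The disagreement of the agents: the largest distance between two of the states `x i`. -/
def disagreement (x : ι → E) : ℝ := Metric.diam (Set.range x)

theorem disagreement_nonneg (x : ι → E) : 0 ≤ disagreement x := Metric.diam_nonneg

theorem norm_sub_le_disagreement [Finite ι] (x : ι → E) (i j : ι) :
    ‖x i - x j‖ ≤ disagreement x := by
  rw [← dist_eq_norm]
  exact Metric.dist_le_diam_of_mem (Set.finite_range x).isBounded (Set.mem_range_self i)
    (Set.mem_range_self j)

theorem disagreement_le {x : ι → E} {c : ℝ} (hc : 0 ≤ c) (hx : ∀ i j, ‖x i - x j‖ ≤ c) :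
    disagreement x ≤ c := by
  refine Metric.diam_le_of_forall_dist_le hc ?_
  rintro _ ⟨i, rfl⟩ _ ⟨j, rfl⟩
  exact (dist_eq_norm _ _).trans_le (hx i j)

theorem disagreement_le_two_mul {x : ι → E} {c : ℝ} (hc : 0 ≤ c) (hx : ∀ i, ‖x i‖ ≤ c) :
    disagreement x ≤ 2 * c :=
  disagreement_le (by positivity) fun i j =>
    (norm_sub_le _ _).trans ((add_le_add (hx i) (hx j)).trans_eq (two_mul c).symm)

theorem disagreement_le_add_two_mul [Finite ι] {x y : ι → E} {c : ℝ} (hc : 0 ≤ c)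
    (hxy : ∀ i, ‖x i - y i‖ ≤ c) : disagreement x ≤ disagreement y + 2 * c := by
  refine disagreement_le (add_nonneg (disagreement_nonneg y) (by positivity)) fun i j => ?_
  calc ‖x i - x j‖ = ‖(x i - y i) + (y i - y j) - (x j - y j)‖ := by congr 1; abel
    _ ≤ ‖x i - y i‖ + ‖y i - y j‖ + ‖x j - y j‖ :=
        (norm_sub_le _ _).trans (add_le_add_left (norm_add_le _ _) _)
    _ ≤ c + disagreement y + c :=
        add_le_add_three (hxy i) (norm_sub_le_disagreement y i j) (hxy j)
    _ = disagreement y + 2 * c := by ring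

variable [NormedSpace ℝ E] [Fintype ι]

theorem norm_sum_smul_sub_sum_smul_le {α β : ι → ℝ} (hα : ∀ i, 0 ≤ α i) (hβ : ∀ i, 0 ≤ β i)
    (hαβ : ∑ i, α i = ∑ i, β i) (x : ι → E) :
    ‖∑ i, α i • x i - ∑ i, β i • x i‖ ≤ (∑ i, α i) * disagreement x := by
  rcases (Finset.sum_nonneg fun i _ => hα i).eq_or_lt with hzero | hpos
  · have hα0 := (Finset.sum_eq_zero_iff_of_nonneg fun i _ => hα i).1 hzero.symm
    have hβ0 := (Finset.sum_eq_zero_iff_of_nonneg fun i _ => hβ i).1 (hzero.trans hαβ).symm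
    simp [hα0, hβ0]
  · have hcenter : ∀ γ : ι → ℝ, (∀ i, 0 ≤ γ i) → ∑ i, α i = ∑ i, γ i →
        Finset.univ.centerMass γ x ∈ convexHull ℝ (Set.range x) ∧
          ∑ i, γ i • x i = (∑ i, α i) • Finset.univ.centerMass γ x := fun γ hγ hαγ =>
      ⟨Finset.centerMass_mem_convexHull _ (fun i _ => hγ i) (hαγ ▸ hpos)
          fun i _ => Set.mem_range_self i,
        by rw [Finset.centerMass, ← hαγ, smul_inv_smul₀ hpos.ne']⟩
    obtain ⟨hα_mem, hα_eq⟩ := hcenter α hα rfl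
    obtain ⟨hβ_mem, hβ_eq⟩ := hcenter β hβ hαβ
    rw [hα_eq, hβ_eq, ← smul_sub, norm_smul, Real.norm_of_nonneg hpos.le, ← dist_eq_norm]
    refine mul_le_mul_of_nonneg_left ?_ hpos.le
    rw [disagreement, ← convexHull_diam]
    exact Metric.dist_le_diam_of_mem
      (isBounded_convexHull.2 (Set.finite_range x).isBounded) hα_mem hβ_mem

variable [DecidableEq ι] {P : Matrix ι ι ℝ}

theorem norm_sum_smul_le_of_mem_rowStochastic (hP : P ∈ Matrix.rowStochastic ℝ ι) {x : ι → E}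
    {c : ℝ} (hx : ∀ j, ‖x j‖ ≤ c) (i : ι) : ‖∑ j, P i j • x j‖ ≤ c := by
  have hmem : ∑ j, P i j • x j ∈ Metric.closedBall (0 : E) c :=
    (convex_closedBall 0 c).sum_mem (fun j _ => Matrix.nonneg_of_mem_rowStochastic hP)
      (Matrix.sum_row_of_mem_rowStochastic hP i) fun j _ => mem_closedBall_zero_iff.2 (hx j)
  exact mem_closedBall_zero_iff.1 hmem

-- Doeblin's argument: all rows of `P` put mass `ε` on the agent `m`, and this common part cancels
-- in the difference of two rows.
theorem disagreement_sum_smul_le (hP : P ∈ Matrix.rowStochastic ℝ ι) {ε : ℝ} {m : ι}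
    (hε : ∀ i, ε ≤ P i m) (x : ι → E) :
    disagreement (fun i => ∑ j, P i j • x j) ≤ (1 - ε) * disagreement x := by
  let Q : ι → ι → ℝ := fun i => P i - Pi.single m ε
  have hQ_nonneg : ∀ i j, 0 ≤ Q i j := fun i j => by
    rcases eq_or_ne j m with rfl | hj
    · simpa [Q] using hε i
    · simpa [Q, hj] using Matrix.nonneg_of_mem_rowStochastic hP
  have hQ_sum : ∀ i, ∑ j, Q i j = 1 - ε := fun i => by
    simp [Q, Matrix.sum_row_of_mem_rowStochastic hP i]
  have hPQ : ∀ i j, ∑ k, P i k • x k - ∑ k, P j k • x k = ∑ k, Q i k • x k - ∑ k, Q j k • x k :=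
    fun i j => by simp only [← Finset.sum_sub_distrib, ← sub_smul, Q, Pi.sub_apply,
      sub_sub_sub_cancel_right]
  have hε1 : 0 ≤ 1 - ε := hQ_sum m ▸ Finset.sum_nonneg fun j _ => hQ_nonneg m j
  refine disagreement_le (mul_nonneg hε1 (disagreement_nonneg x)) fun i j => ?_
  rw [hPQ, ← hQ_sum i]
  exact norm_sum_smul_sub_sum_smul_le (hQ_nonneg i) (hQ_nonneg j)
    ((hQ_sum i).trans (hQ_sum j).symm) x

/-- The transition matrix `W (s + k - 1) * ⋯ * W s` of `k` averaging steps from time `s` on. -/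
def transition (W : ℕ → Matrix ι ι ℝ) (s : ℕ) : ℕ → Matrix ι ι ℝ
  | 0 => 1
  | k + 1 => W (s + k) * transition W s k

variable {W : ℕ → Matrix ι ι ℝ} {s k : ℕ}

theorem transition_mem_rowStochastic (hW : ∀ r < k, W (s + r) ∈ Matrix.rowStochastic ℝ ι) :
    transition W s k ∈ Matrix.rowStochastic ℝ ι := by
  induction k with
  | zero => exact one_mem _
  | succ k ih => exact mul_mem (hW k k.lt_succ_self) (ih fun r hr => hW r (hr.trans k.lt_succ_self))

variable {x : ℕ → ι → E} {e : ℕ → ℝ}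

theorem norm_sub_transition_le (hW : ∀ r < k, W (s + r) ∈ Matrix.rowStochastic ℝ ι)
    (hx : ∀ r < k, ∀ i, ‖x (s + r + 1) i - ∑ j, W (s + r) i j • x (s + r) j‖ ≤ e (s + r)) (i : ι) :
    ‖x (s + k) i - ∑ j, transition W s k i j • x s j‖ ≤ ∑ r ∈ Finset.range k, e (s + r) := by
  induction k generalizing i with
  | zero => simp [transition, Matrix.one_apply]
  | succ k ih =>
    have hprev := ih (fun r hr => hW r (hr.trans k.lt_succ_self))
      fun r hr => hx r (hr.trans k.lt_succ_self)
    have hstep : ∑ j, transition W s (k + 1) i j • x s j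
        = ∑ l, W (s + k) i l • ∑ j, transition W s k l j • x s j := by
      simp only [transition, Matrix.mul_apply, Finset.sum_smul, Finset.smul_sum, mul_smul]
      exact Finset.sum_comm
    have hsplit : x (s + k + 1) i - ∑ j, transition W s (k + 1) i j • x s j
        = ∑ l, W (s + k) i l • (x (s + k) l - ∑ j, transition W s k l j • x s j)
          + (x (s + k + 1) i - ∑ j, W (s + k) i j • x (s + k) j) := by
      simp only [hstep, smul_sub, Finset.sum_sub_distrib]
      abel
    rw [← add_assoc, hsplit, Finset.sum_range_succ]
    exact (norm_add_le _ _).trans (add_le_add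
      (norm_sum_smul_le_of_mem_rowStochastic (hW k k.lt_succ_self) hprev i)
      (hx k k.lt_succ_self i))

theorem disagreement_add_le (hW : ∀ r < k, W (s + r) ∈ Matrix.rowStochastic ℝ ι)
    (hx : ∀ r < k, ∀ i, ‖x (s + r + 1) i - ∑ j, W (s + r) i j • x (s + r) j‖ ≤ e (s + r))
    {ε : ℝ} {m : ι} (hε : ∀ i, ε ≤ transition W s k i m) :
    disagreement (x (s + k)) ≤
      (1 - ε) * disagreement (x s) + 2 * ∑ r ∈ Finset.range k, e (s + r) := by
  have hclose := norm_sub_transition_le hW hx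
  refine (disagreement_le_add_two_mul ((norm_nonneg _).trans (hclose m)) hclose).trans ?_
  gcongr
  exact disagreement_sum_smul_le (transition_mem_rowStochastic hW) hε (x s)

end Disagreement

/-! ### Propagation of messages through the network -/

section Network

variable {N : ℕ} {w : ℝ} {B : ℕ} {edge : ℕ → Fin N → Fin N → Prop}
  {W : ℕ → Matrix (Fin N) (Fin N) ℝ} {s k : ℕ} {i j m : Fin N}

theorem NetworkAssumption.mem_rowStochastic (h : NetworkAssumption w B edge W) (hw : 0 < w)
    {t : ℕ} (ht : 1 ≤ t) : W t ∈ Matrix.rowStochastic ℝ (Fin N) := by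
  refine Matrix.mem_rowStochastic_iff_sum.2 ⟨fun i j => ?_, h.row_sum t ht⟩
  by_cases hij : edge t i j ∨ j = i
  · exact hw.le.trans (h.weight_ge t ht i j hij)
  · exact (h.weight_eq_zero t ht i j hij).ge

theorem NetworkAssumption.pow_succ_le_transition (h : NetworkAssumption w B edge W) (hw : 0 < w)
    (hs : 1 ≤ s) (hij : edge (s + k) i j ∨ j = i) (hj : w ^ k ≤ transition W s k j m) :
    w ^ (k + 1) ≤ transition W s (k + 1) i m := by
  have hW : ∀ r, W (s + r) ∈ Matrix.rowStochastic ℝ (Fin N) := fun r =>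
    h.mem_rowStochastic hw (le_add_right hs)
  have hT := transition_mem_rowStochastic (k := k) fun r _ => hW r
  calc w ^ (k + 1) = w * w ^ k := pow_succ' w k
    _ ≤ W (s + k) i j * transition W s k j m :=
        mul_le_mul (h.weight_ge _ (le_add_right hs) i j hij) hj (by positivity)
          (Matrix.nonneg_of_mem_rowStochastic (hW k))
    _ ≤ ∑ l, W (s + k) i l * transition W s k l m :=
        Finset.single_le_sum (f := fun l => W (s + k) i l * transition W s k l m)
          (fun l _ => mul_nonneg (Matrix.nonneg_of_mem_rowStochastic (hW k))
            (Matrix.nonneg_of_mem_rowStochastic hT)) (Finset.mem_univ j)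
    _ = transition W s (k + 1) i m := (Matrix.mul_apply ..).symm

theorem NetworkAssumption.pow_add_le_transition (h : NetworkAssumption w B edge W) (hw : 0 < w)
    (hs : 1 ≤ s) (hi : w ^ k ≤ transition W s k i m) (l : ℕ) :
    w ^ (k + l) ≤ transition W s (k + l) i m := by
  induction l with
  | zero => exact hi
  | succ l ih => exact h.pow_succ_le_transition hw hs (Or.inr rfl) ih

/-- The agents that the message sent by agent `m` at time `s` has reached after `k` steps, with at
least the weight `w ^ k` that a path of length `k` guarantees. -/
def reached (w : ℝ) (W : ℕ → Matrix (Fin N) (Fin N) ℝ) (s : ℕ) (m : Fin N) (k : ℕ) :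
    Set (Fin N) :=
  {i | w ^ k ≤ transition W s k i m}

theorem NetworkAssumption.reached_mono (h : NetworkAssumption w B edge W) (hw : 0 < w)
    (hs : 1 ≤ s) (m : Fin N) : Monotone (reached w W s m) := fun k l hkl i hi => by
  rw [← Nat.add_sub_cancel' hkl]
  exact h.pow_add_le_transition hw hs hi (l - k)

theorem NetworkAssumption.mem_reached_self (h : NetworkAssumption w B edge W) (hw : 0 < w)
    (hs : 1 ≤ s) (m : Fin N) (k : ℕ) : m ∈ reached w W s m k :=
  h.reached_mono hw hs m k.zero_le (by simp [reached, transition])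

theorem exists_mem_of_reflTransGen {V : Type*} {R : V → V → Prop} {S : Set V} {u v : V}
    (huv : Relation.ReflTransGen R u v) (hu : u ∉ S) (hv : v ∈ S) :
    ∃ y z, R y z ∧ y ∉ S ∧ z ∈ S := by
  induction huv using Relation.ReflTransGen.head_induction_on with
  | refl => exact absurd hv hu
  | @head y z hyz _ ih =>
    by_cases hz : z ∈ S
    · exact ⟨y, z, hyz, hu, hz⟩
    · exact ih hz

theorem NetworkAssumption.reached_ssubset (h : NetworkAssumption w B edge W) (hw : 0 < w)
    (hs : 1 ≤ s) (hk : reached w W s m k ≠ Set.univ) :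
    reached w W s m k ⊂ reached w W s m (k + B) := by
  obtain ⟨i, hi⟩ := (Set.ne_univ_iff_exists_notMem _).1 hk
  obtain ⟨u, v, ⟨l, hl, huv⟩, hu, hv⟩ := exists_mem_of_reflTransGen
    (h.connected (s + k) (le_add_right hs) i m) hi (h.mem_reached_self hw hs m k)
  have hu' : u ∈ reached w W s m (k + l + 1) :=
    h.pow_succ_le_transition hw hs (Or.inl (by rwa [← add_assoc]))
      (h.reached_mono hw hs m (k.le_add_right l) hv)
  exact Set.ssubset_iff_exists.2 ⟨h.reached_mono hw hs m (k.le_add_right B),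
    u, h.reached_mono hw hs m (by lia) hu', hu⟩

theorem NetworkAssumption.min_le_ncard_reached (h : NetworkAssumption w B edge W) (hw : 0 < w)
    (hs : 1 ≤ s) (m : Fin N) (n : ℕ) : min N n ≤ (reached w W s m (n * B)).ncard := by
  induction n with
  | zero => simp
  | succ n ih =>
    rw [Nat.succ_mul]
    by_cases hfull : reached w W s m (n * B) = Set.univ
    · have hsub := h.reached_mono hw hs m (Nat.le_add_right (n * B) B)
      rw [hfull, Set.univ_subset_iff] at hsub
      simp [hsub, Set.ncard_univ]
    · have hlt := Set.ncard_lt_ncard (h.reached_ssubset hw hs hfull)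
      lia

theorem NetworkAssumption.pow_le_transition (h : NetworkAssumption w B edge W) (hw : 0 < w)
    (hs : 1 ≤ s) (i m : Fin N) : w ^ (N * B) ≤ transition W s (N * B) i m := by
  have hcard := h.min_le_ncard_reached hw hs m N
  have huniv : reached w W s m (N * B) = Set.univ :=
    Set.eq_of_subset_of_ncard_le (Set.subset_univ _) (by simpa [Set.ncard_univ] using hcard)
  exact (huniv ▸ Set.mem_univ i : i ∈ reached w W s m (N * B))

end Network

/-! ### The accumulated disagreement -/

section Window

variable {a e : ℕ → ℝ} {D ρ : ℝ}

theorem sum_range_le_mul_add_sum_range_shift {n : ℕ} (hD : 0 ≤ D) (haD : ∀ t < n, a t ≤ D)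
    (M : ℕ) : ∑ t ∈ Finset.range n, a t ≤ M * D + ∑ t ∈ Finset.range (n - M), a (t + M) := by
  have hbound : ∀ m ≤ n, ∑ t ∈ Finset.range m, a t ≤ m * D := fun m hm => by
    simpa using Finset.sum_le_card_nsmul (Finset.range m) a D
      fun t ht => haD t ((Finset.mem_range.1 ht).trans_le hm)
  rcases le_total n M with hnM | hMn
  · rw [Nat.sub_eq_zero_of_le hnM, Finset.sum_range_zero, add_zero]
    exact (hbound n le_rfl).trans (by gcongr)
  · obtain ⟨m, rfl⟩ := Nat.exists_eq_add_of_le hMn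
    rw [Finset.sum_range_add, Nat.add_sub_cancel_left]
    simp only [add_comm M]
    exact add_le_add_left (hbound M hMn) _

theorem sum_range_sum_range_add_le (he : ∀ t, 0 ≤ e t) (n M : ℕ) :
    ∑ t ∈ Finset.range (n - M), ∑ k ∈ Finset.range M, e (t + k) ≤
      M * ∑ t ∈ Finset.range (n - 1), e t := by
  rw [Finset.sum_comm, ← nsmul_eq_mul]
  refine (Finset.sum_le_card_nsmul _ _ _ fun k hk => ?_).trans_eq (by rw [Finset.card_range])
  rw [Finset.mem_range] at hk
  rw [Finset.range_eq_Ico, Finset.sum_Ico_add' e]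
  refine Finset.sum_le_sum_of_subset_of_nonneg (fun t ht => ?_) fun t _ _ => he t
  simp only [Finset.mem_Ico, Finset.mem_range] at ht ⊢
  lia

theorem sum_range_le_of_contraction {n M : ℕ} (he : ∀ t, 0 ≤ e t) (ha : ∀ t, 0 ≤ a t)
    (hD : 0 ≤ D) (haD : ∀ t < n, a t ≤ D) (hρ : 0 ≤ ρ)
    (hstep : ∀ t, t + M < n → a (t + M) ≤ ρ * a t + ∑ k ∈ Finset.range M, e (t + k)) :
    (1 - ρ) * ∑ t ∈ Finset.range n, a t ≤ M * (D + ∑ t ∈ Finset.range (n - 1), e t) := by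
  have hshift : ∑ t ∈ Finset.range (n - M), a (t + M) ≤
      ρ * ∑ t ∈ Finset.range n, a t + M * ∑ t ∈ Finset.range (n - 1), e t := by
    calc ∑ t ∈ Finset.range (n - M), a (t + M)
        ≤ ∑ t ∈ Finset.range (n - M), (ρ * a t + ∑ k ∈ Finset.range M, e (t + k)) :=
          Finset.sum_le_sum fun t ht => hstep t (by rw [Finset.mem_range] at ht; lia)
      _ = ρ * ∑ t ∈ Finset.range (n - M), a t
            + ∑ t ∈ Finset.range (n - M), ∑ k ∈ Finset.range M, e (t + k) := by
          rw [Finset.sum_add_distrib, Finset.mul_sum]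
      _ ≤ _ := by
          refine add_le_add (mul_le_mul_of_nonneg_left ?_ hρ) (sum_range_sum_range_add_le he n M)
          exact Finset.sum_le_sum_of_subset_of_nonneg
            (Finset.range_subset_range.2 (n.sub_le M)) fun t _ _ => ha t
  linarith [sum_range_le_mul_add_sum_range_shift hD haD M]

end Window

section AccumulatedDisagreement

variable {N : ℕ} {w : ℝ} {B : ℕ} {edge : ℕ → Fin N → Fin N → Prop}
  {W : ℕ → Matrix (Fin N) (Fin N) ℝ} {E : Type*} [NormedAddCommGroup E] [NormedSpace ℝ E]

theorem NetworkAssumption.disagreement_add_le (h : NetworkAssumption w B edge W) (hw : 0 < w)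
    (m : Fin N) {x : ℕ → Fin N → E} {e : ℕ → ℝ} {s : ℕ} (hs : 1 ≤ s)
    (hx : ∀ r < N * B, ∀ i, ‖x (s + r + 1) i - ∑ j, W (s + r) i j • x (s + r) j‖ ≤ e (s + r)) :
    disagreement (x (s + N * B)) ≤ (1 - w ^ (N * B)) * disagreement (x s)
      + 2 * ∑ r ∈ Finset.range (N * B), e (s + r) :=
  ODCSGD.disagreement_add_le (fun _ _ => h.mem_rowStochastic hw (le_add_right hs)) hx
    fun i => h.pow_le_transition hw hs i m

theorem NetworkAssumption.sum_disagreement_le (h : NetworkAssumption w B edge W) (hw : 0 < w)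
    (hN : 0 < N) {x : ℕ → Fin N → E} {e : ℕ → ℝ} (he : ∀ t, 1 ≤ t → 0 ≤ e t) {T : ℕ}
    (hx : ∀ t ∈ Finset.Ico 1 T, ∀ i, ‖x (t + 1) i - ∑ j, W t i j • x t j‖ ≤ e t)
    {R : ℝ} (hR : 0 ≤ R) (hxR : ∀ t ∈ Finset.Icc 1 T, ∀ i, ‖x t i‖ ≤ R) :
    w ^ (N * B) * ∑ t ∈ Finset.Icc 1 T, disagreement (x t) ≤
      (N * B : ℕ) * (2 * R + 2 * ∑ t ∈ Finset.Ico 1 T, e t) := by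
  have hρ : 0 ≤ 1 - w ^ (N * B) := sub_nonneg.2 <|
    (h.pow_le_transition hw le_rfl ⟨0, hN⟩ ⟨0, hN⟩).trans <| Matrix.le_one_of_mem_rowStochastic <|
      transition_mem_rowStochastic fun r _ => h.mem_rowStochastic hw (Nat.le_add_right 1 r)
  have hsum := sum_range_le_of_contraction (n := T) (M := N * B) (ρ := 1 - w ^ (N * B))
    (a := fun t => disagreement (x (1 + t))) (e := fun t => 2 * e (1 + t)) (D := 2 * R)
    (fun t => mul_nonneg two_pos.le (he _ (Nat.le_add_right 1 t)))
    (fun t => disagreement_nonneg _) (by positivity)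
    (fun t ht => disagreement_le_two_mul hR (hxR _ (Finset.mem_Icc.2 (by lia)))) hρ
    fun t ht => by
      simpa only [add_assoc, Finset.mul_sum] using h.disagreement_add_le hw ⟨0, hN⟩ (x := x)
        (Nat.le_add_right 1 t) fun r hr => hx _ (Finset.mem_Ico.2 (by lia))
  rw [← Finset.Ico_add_one_right_eq_Icc, Finset.sum_Ico_eq_sum_range, Finset.sum_Ico_eq_sum_range]
  simpa [← Finset.mul_sum] using hsum

end AccumulatedDisagreement

/-! ### Smooth functions -/

section Smooth

theorem sq_norm_le_of_lipschitzWith {E F : Type*} [SeminormedAddCommGroup E]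
    [SeminormedAddCommGroup F] {K : ℝ≥0} {u : E → F} (hu : LipschitzWith K u) (x z : E) :
    ‖u x‖ ^ 2 ≤ 2 * ‖u z‖ ^ 2 + 2 * (K * ‖x - z‖) ^ 2 := by
  calc ‖u x‖ ^ 2 ≤ (‖u z‖ + ‖u x - u z‖) ^ 2 := by
        gcongr
        exact norm_le_norm_add_norm_sub' _ _
    _ ≤ 2 * (‖u z‖ ^ 2 + ‖u x - u z‖ ^ 2) := add_sq_le
    _ ≤ 2 * (‖u z‖ ^ 2 + (K * ‖x - z‖) ^ 2) := by
        gcongr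
        exact hu.norm_sub_le x z
    _ = _ := mul_add _ _ _

variable {E : Type*} [NormedAddCommGroup E] [InnerProductSpace ℝ E] [CompleteSpace E]
  {K : ℝ≥0} {h : E → ℝ}

theorem abs_sub_sub_inner_gradient_le (hd : Differentiable ℝ h) (hK : LipschitzWith K (gradient h))
    (x y : E) : |h y - h x - inner ℝ (gradient h x) (y - x)| ≤ K * ‖y - x‖ ^ 2 := by
  have hderiv : ∀ z ∈ segment ℝ x y,
      HasFDerivWithinAt h (InnerProductSpace.toDual ℝ E (gradient h z)) (segment ℝ x y) z :=
    fun z _ => (hd z).hasGradientAt.hasFDerivAt.hasFDerivWithinAt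
  have hbound : ∀ z ∈ segment ℝ x y,
      ‖InnerProductSpace.toDual ℝ E (gradient h z) - InnerProductSpace.toDual ℝ E (gradient h x)‖
        ≤ K * ‖y - x‖ := by
    intro z hz
    rw [← map_sub, LinearIsometryEquiv.norm_map]
    refine (hK.norm_sub_le z x).trans (mul_le_mul_of_nonneg_left ?_ K.2)
    simpa [norm_sub_rev] using norm_sub_le_of_mem_segment hz
  have hmean := (convex_segment x y).norm_image_sub_le_of_norm_hasFDerivWithin_le' hderiv hbound
    (left_mem_segment ℝ x y) (right_mem_segment ℝ x y)
  rwa [InnerProductSpace.toDual_apply_apply, Real.norm_eq_abs, mul_assoc, ← sq] at hmean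

theorem inner_gradient_le (hd : Differentiable ℝ h) (hK : LipschitzWith K (gradient h)) {η : ℝ}
    (hη : 0 < η) (z v : E) :
    inner ℝ (gradient h z) v ≤ η⁻¹ * (h z - h (z - η • v)) + K * (η * ‖v‖ ^ 2) := by
  have htaylor := (le_abs_self _).trans (abs_sub_sub_inner_gradient_le hd hK z (z - η • v))
  rw [sub_sub_cancel_left, inner_neg_right, real_inner_smul_right, norm_neg, norm_smul,
    Real.norm_of_nonneg hη.le] at htaylor
  rw [← mul_le_mul_iff_right₀ hη, mul_add, mul_inv_cancel_left₀ hη.ne']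
  linarith

end Smooth

section GlobalCost

variable {N d : ℕ} {L : ℝ≥0} {f : Fin N → ℕ → Vec d → ℝ} {t : ℕ}

theorem gradient_globalCost (hf : ∀ i, Differentiable ℝ (f i t)) (x : Vec d) :
    gradient (globalCost f t) x = ∑ i, gradient (f i t) x := by
  apply HasGradientAt.gradient
  rw [hasGradientAt_iff_hasFDerivAt, map_sum]
  exact HasFDerivAt.fun_sum fun i _ => (hf i x).hasGradientAt.hasFDerivAt

theorem LSmooth.globalCost (hf : ∀ i, LSmooth L (f i t)) : LSmooth (N * L) (globalCost f t) := by
  refine ⟨Differentiable.fun_sum fun i _ => (hf i).1, LipschitzWith.of_dist_le_mul fun x y => ?_⟩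
  rw [gradient_globalCost fun i => (hf i).1, gradient_globalCost fun i => (hf i).1]
  refine (dist_sum_sum_le _ _ _).trans ?_
  refine (Finset.sum_le_sum fun i _ => (hf i).2.dist_le_mul x y).trans_eq ?_
  simp [mul_assoc]

theorem norm_gradient_globalCost_le (hf : ∀ i, Differentiable ℝ (f i t)) {z : Vec d} {Bg : ℝ}
    (hg : ∀ i, ‖gradient (f i t) z‖ ≤ Bg) : ‖gradient (globalCost f t) z‖ ≤ N * Bg := by
  rw [gradient_globalCost hf]
  exact (norm_sum_le _ _).trans ((Finset.sum_le_sum fun i _ => hg i).trans_eq (by simp))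

theorem abs_globalCost_sub_le (hf : ∀ i, LSmooth L (f i t)) {x y : Vec d} {Bg R : ℝ}
    (hg : ∀ i, ‖gradient (f i t) x‖ ≤ Bg) (hxy : ‖y - x‖ ≤ R) :
    |globalCost f t y - globalCost f t x| ≤ N * Bg * R + N * L * R ^ 2 := by
  have hgrad := norm_gradient_globalCost_le (fun i => (hf i).1) hg
  have hsmooth := LSmooth.globalCost hf
  have htaylor := abs_sub_sub_inner_gradient_le hsmooth.1 hsmooth.2 x y
  have hinner : |inner ℝ (gradient (globalCost f t) x) (y - x)| ≤ N * Bg * R :=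
    (abs_real_inner_le_norm _ _).trans
      (mul_le_mul hgrad hxy (norm_nonneg _) ((norm_nonneg _).trans hgrad))
  have hquad : (N * L : ℝ) * ‖y - x‖ ^ 2 ≤ N * L * R ^ 2 := by gcongr
  rw [NNReal.coe_mul, NNReal.coe_natCast] at htaylor
  linarith [abs_sub_abs_le_abs_sub (globalCost f t y - globalCost f t x)
    (inner ℝ (gradient (globalCost f t) x) (y - x))]

end GlobalCost

section Average

variable {N d : ℕ}

theorem average_sub (x y : Fin N → Vec d) :
    average (fun i => x i - y i) = average x - average y := by
  simp only [average, Finset.sum_sub_distrib, smul_sub]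

theorem inner_average (u : Vec d) (x : Fin N → Vec d) :
    inner ℝ u (average x) = (N : ℝ)⁻¹ * ∑ i, inner ℝ u (x i) := by
  rw [average, real_inner_smul_right, inner_sum]

theorem norm_average_le {x : Fin N → Vec d} {c : ℝ} (hc : 0 ≤ c) (hx : ∀ i, ‖x i‖ ≤ c) :
    ‖average x‖ ≤ c := by
  have hsum : ‖∑ i, x i‖ ≤ N * c :=
    (norm_sum_le _ _).trans ((Finset.sum_le_sum fun i _ => hx i).trans_eq (by simp))
  rw [average, norm_smul, norm_inv, RCLike.norm_natCast]
  exact inv_mul_le_of_le_mul₀ N.cast_nonneg hc hsum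

theorem norm_sub_average_le_disagreement (x : Fin N → Vec d) (i : Fin N) :
    ‖x i - average x‖ ≤ disagreement x := by
  have hN : (N : ℝ) ≠ 0 := Nat.cast_ne_zero.2 i.pos.ne'
  have hdiff : x i - average x = average fun j => x i - x j := by
    simp [average, ← Nat.cast_smul_eq_nsmul ℝ, smul_sub, hN]
  rw [hdiff]
  exact norm_average_le (disagreement_nonneg x) (norm_sub_le_disagreement x i)

theorem average_sum_smul_sub {W : Matrix (Fin N) (Fin N) ℝ} (hW : ∀ j, ∑ i, W i j = 1) (η : ℝ)
    (x c : Fin N → Vec d) :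
    average (fun i => ∑ j, W i j • x j - η • c i) = average x - η • average c := by
  rw [average_sub]
  congr 1
  · rw [average, average, Finset.sum_comm]
    simp only [← Finset.sum_smul, hW, one_smul]
  · rw [average, average, ← Finset.smul_sum, smul_comm]

end Average

/-! ### Descent along a trajectory -/

section Descent

variable {N d : ℕ} {L : ℝ≥0} {f : Fin N → ℕ → Vec d → ℝ} {t : ℕ}

/-- The contribution of clipping and noise to the descent at time `t`: the inner product of the
global gradient at the average state with the mean deviation of the clipped observations `c i` from
the local gradients. -/
def clipError (f : Fin N → ℕ → Vec d → ℝ) (t : ℕ) (x c : Fin N → Vec d) : ℝ :=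
  inner ℝ (gradient (globalCost f t) (average x))
    (average fun i => gradient (f i t) (x i) - c i)

theorem sq_norm_gradient_average_le_inner_add (hf : ∀ i, LSmooth L (f i t)) {x : Fin N → Vec d}
    {Bg : ℝ} (hg : ∀ i, ‖gradient (f i t) (average x)‖ ≤ Bg) (c : Fin N → Vec d) :
    (N : ℝ)⁻¹ * ‖gradient (globalCost f t) (average x)‖ ^ 2
      ≤ inner ℝ (gradient (globalCost f t) (average x)) (average c) + clipError f t x c
        + N * Bg * (L * disagreement x) := by
  set u := gradient (globalCost f t) (average x) with hu
  have hu_norm : ‖u‖ ≤ N * Bg := norm_gradient_globalCost_le (fun i => (hf i).1) hg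
  have hu_average : (N : ℝ)⁻¹ • u = average fun i => gradient (f i t) (average x) := by
    rw [hu, gradient_globalCost fun i => (hf i).1]
    rfl
  have hdecomp : (N : ℝ)⁻¹ * ‖u‖ ^ 2 = inner ℝ u (average c) + clipError f t x c
      - inner ℝ u (average fun i => gradient (f i t) (x i) - gradient (f i t) (average x)) := by
    rw [clipError, ← hu, average_sub, average_sub, ← hu_average, inner_sub_right, inner_sub_right,
      real_inner_smul_right, real_inner_self_eq_norm_sq]
    ring
  have hdrift : ‖average fun i => gradient (f i t) (x i) - gradient (f i t) (average x)‖
      ≤ L * disagreement x :=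
    norm_average_le (mul_nonneg L.2 (disagreement_nonneg x)) fun i =>
      ((hf i).2.norm_sub_le _ _).trans
        (mul_le_mul_of_nonneg_left (norm_sub_average_le_disagreement x i) L.2)
  have hinner := (neg_le_abs _).trans ((abs_real_inner_le_norm u _).trans
    (mul_le_mul hu_norm hdrift (norm_nonneg _) ((norm_nonneg _).trans hu_norm)))
  linarith

theorem sum_sq_norm_gradient_le (hf : ∀ i, LSmooth L (f i t)) {x : Fin N → Vec d} {BX : ℝ}
    (hBX : 0 ≤ BX) (hx : ∀ i, ‖x i‖ ≤ BX) :
    ∑ i, ‖gradient (globalCost f t) (x i)‖ ^ 2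
      ≤ 2 * N * ‖gradient (globalCost f t) (average x)‖ ^ 2
        + 4 * N * (N * L) ^ 2 * BX * disagreement x := by
  have hdis := disagreement_nonneg x
  have hterm : ∀ i, ‖gradient (globalCost f t) (x i)‖ ^ 2
      ≤ 2 * ‖gradient (globalCost f t) (average x)‖ ^ 2
        + 2 * ((N * L) ^ 2 * (2 * BX * disagreement x)) := fun i => by
    have hlip := sq_norm_le_of_lipschitzWith (LSmooth.globalCost hf).2 (x i) (average x)
    rw [NNReal.coe_mul, NNReal.coe_natCast, mul_pow] at hlip
    refine hlip.trans ?_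
    gcongr
    calc ‖x i - average x‖ ^ 2 ≤ disagreement x ^ 2 := by
          gcongr
          exact norm_sub_average_le_disagreement x i
      _ = disagreement x * disagreement x := sq _
      _ ≤ 2 * BX * disagreement x := by
          gcongr
          exact disagreement_le_two_mul hBX hx
  refine (Finset.sum_le_sum fun i _ => hterm i).trans_eq ?_
  rw [Finset.sum_const, Finset.card_univ, Fintype.card_fin, nsmul_eq_mul]
  ring

theorem sum_Ico_mul_sub_succ_le {θ φ : ℕ → ℝ} {K : ℝ} {m n : ℕ} (hmn : m ≤ n) (hθm : 0 ≤ θ m)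
    (hθ : MonotoneOn θ (Set.Ici m)) (hφ : ∀ t ∈ Finset.Icc m n, φ t ≤ K) :
    ∑ t ∈ Finset.Ico m n, θ t * (φ t - φ (t + 1)) ≤ θ n * (K - φ n) := by
  induction n, hmn using Nat.le_induction with
  | base => simpa using mul_nonneg hθm (sub_nonneg.2 (hφ m (by simp)))
  | succ n hmn ih =>
    have hprev := ih fun t ht => hφ t (Finset.Icc_subset_Icc_right n.le_succ ht)
    have hlast := hφ (n + 1) (Finset.mem_Icc.2 ⟨hmn.trans n.le_succ, le_rfl⟩)
    rw [Finset.sum_Ico_succ_top hmn]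
    calc _ ≤ θ n * (K - φ n) + θ n * (φ n - φ (n + 1)) := add_le_add_left hprev _
      _ = θ n * (K - φ (n + 1)) := by ring
      _ ≤ θ (n + 1) * (K - φ (n + 1)) :=
          mul_le_mul_of_nonneg_right (hθ hmn (hmn.trans n.le_succ) n.le_succ)
            (sub_nonneg.2 hlast)

end Descent

section Variation

variable {N d : ℕ} {f : Fin N → ℕ → Vec d → ℝ} {T : ℕ}

theorem variation_eq_sum_Ico : variation f T =
    ∑ t ∈ Finset.Ico 1 T, ⨆ z, |globalCost f (t + 1) z - globalCost f t z| := by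
  rw [variation, ← Finset.Ico_add_one_right_eq_Icc]
  exact (Finset.sum_Ico_add'
    (fun t => ⨆ z, |globalCost f t z - globalCost f (t - 1) z|) 1 T 1).symm

theorem variation_nonneg : 0 ≤ variation f T :=
  Finset.sum_nonneg fun _ _ => Real.iSup_nonneg fun _ => abs_nonneg _

theorem abs_globalCost_succ_sub_le (hfin : FiniteVariation f T) {t : ℕ}
    (ht : t ∈ Finset.Ico 1 T) (z : Vec d) : |globalCost f (t + 1) z - globalCost f t z|
      ≤ ⨆ z, |globalCost f (t + 1) z - globalCost f t z| := by
  rw [Finset.mem_Ico] at ht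
  exact le_ciSup (hfin (t + 1) (Finset.mem_Icc.2 ⟨by lia, ht.2⟩)) z

theorem abs_globalCost_sub_globalCost_one_le (hfin : FiniteVariation f T) {t : ℕ}
    (ht : t ∈ Finset.Icc 1 T) (z : Vec d) :
    |globalCost f t z - globalCost f 1 z| ≤ variation f T := by
  rw [Finset.mem_Icc] at ht
  rw [← Real.dist_eq, dist_comm, variation_eq_sum_Ico]
  refine (dist_le_Ico_sum_of_dist_le (f := fun s => globalCost f s z) ht.1
    fun {s} hs hst => ?_).trans (Finset.sum_le_sum_of_subset_of_nonneg
      (Finset.Ico_subset_Ico_right ht.2) fun s _ _ => Real.iSup_nonneg fun _ => abs_nonneg _)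
  rw [dist_comm, Real.dist_eq]
  exact abs_globalCost_succ_sub_le hfin (Finset.mem_Ico.2 ⟨hs, hst.trans_le ht.2⟩) z

end Variation

section Trajectory

/-- A trajectory of decentralised descent up to time `T` with states `x t i` and descent directions
`c t i`, together with all pathwise assumptions: this separates the deterministic analysis from the
probabilistic one. -/
structure BoundedTrajectory {N d : ℕ} (T : ℕ) (L : ℝ≥0) (BX Bg : ℝ)
    (W : ℕ → Matrix (Fin N) (Fin N) ℝ) (η lam : ℕ → ℝ) (f : Fin N → ℕ → Vec d → ℝ)
    (x c : ℕ → Fin N → Vec d) : Prop where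
  col_sum : ∀ t ∈ Finset.Ico 1 T, ∀ j, ∑ i, W t i j = 1
  step : ∀ t ∈ Finset.Ico 1 T, ∀ i, x (t + 1) i = ∑ j, W t i j • x t j - η t • c t i
  stepSize_pos : ∀ t, 1 ≤ t → 0 < η t
  stepSize_inv_mono : MonotoneOn (fun t => (η t)⁻¹) (Set.Ici 1)
  level_nonneg : ∀ t, 0 ≤ lam t
  norm_direction_le : ∀ t i, ‖c t i‖ ≤ lam t
  smooth : ∀ t ∈ Finset.Icc 1 T, ∀ i, LSmooth L (f i t)
  norm_state_le : ∀ t ∈ Finset.Icc 1 T, ∀ i, ‖x t i‖ ≤ BX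
  norm_gradient_average_le : ∀ t ∈ Finset.Icc 1 T, ∀ i, ‖gradient (f i t) (average (x t))‖ ≤ Bg
  finiteVariation : FiniteVariation f T

namespace BoundedTrajectory

variable {N d T : ℕ} {L : ℝ≥0} {BX Bg : ℝ} {W : ℕ → Matrix (Fin N) (Fin N) ℝ} {η lam : ℕ → ℝ}
  {f : Fin N → ℕ → Vec d → ℝ} {x c : ℕ → Fin N → Vec d} {t : ℕ}

theorem average_succ (h : BoundedTrajectory T L BX Bg W η lam f x c) (ht : t ∈ Finset.Ico 1 T) :
    average (x (t + 1)) = average (x t) - η t • average (c t) := by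
  rw [funext (h.step t ht)]
  exact average_sum_smul_sub (h.col_sum t ht) _ _ _

theorem norm_gradient_average_globalCost_le (h : BoundedTrajectory T L BX Bg W η lam f x c)
    (ht : t ∈ Finset.Icc 1 T) : ‖gradient (globalCost f t) (average (x t))‖ ≤ N * Bg :=
  norm_gradient_globalCost_le (fun i => (h.smooth t ht i).1) (h.norm_gradient_average_le t ht)

theorem inner_average_direction_le (h : BoundedTrajectory T L BX Bg W η lam f x c)
    (ht : t ∈ Finset.Ico 1 T) :
    inner ℝ (gradient (globalCost f t) (average (x t))) (average (c t))
      ≤ (η t)⁻¹ * (globalCost f t (average (x t)) - globalCost f t (average (x (t + 1))))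
        + N * L * (η t * lam t ^ 2) := by
  have hsmooth := LSmooth.globalCost (h.smooth t (Finset.Ico_subset_Icc_self ht))
  have hη := h.stepSize_pos t (Finset.mem_Ico.1 ht).1
  have hdescent := inner_gradient_le hsmooth.1 hsmooth.2 hη (average (x t)) (average (c t))
  have hnorm := norm_average_le (h.level_nonneg t) (h.norm_direction_le t)
  rw [h.average_succ ht]
  rw [NNReal.coe_mul, NNReal.coe_natCast] at hdescent
  exact hdescent.trans (by gcongr)

theorem abs_globalCost_average_sub_le (h : BoundedTrajectory T L BX Bg W η lam f x c)
    (hBX : 0 ≤ BX) (ht : t ∈ Finset.Icc 1 T) :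
    |globalCost f t (average (x t)) - globalCost f 1 (average (x 1))|
      ≤ variation f T + (N * Bg * (2 * BX) + N * L * (2 * BX) ^ 2) := by
  have h1 : 1 ∈ Finset.Icc 1 T := Finset.left_mem_Icc.2 (Finset.nonempty_Icc.1 ⟨t, ht⟩)
  have hdist : ‖average (x t) - average (x 1)‖ ≤ 2 * BX :=
    (norm_sub_le _ _).trans ((add_le_add (norm_average_le hBX (h.norm_state_le t ht))
      (norm_average_le hBX (h.norm_state_le 1 h1))).trans_eq (two_mul BX).symm)
  exact (abs_sub_le _ (globalCost f 1 (average (x t))) _).trans <| add_le_add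
    (abs_globalCost_sub_globalCost_one_le h.finiteVariation ht _)
    (abs_globalCost_sub_le (h.smooth 1 h1) (h.norm_gradient_average_le 1 h1) hdist)

theorem sum_inv_mul_globalCost_sub_le (h : BoundedTrajectory T L BX Bg W η lam f x c)
    (hBX : 0 ≤ BX) (hT : 1 ≤ T) :
    ∑ t ∈ Finset.Ico 1 T, (η t)⁻¹ *
        (globalCost f t (average (x t)) - globalCost f t (average (x (t + 1))))
      ≤ (η T)⁻¹ * (2 * (N * Bg * (2 * BX) + N * L * (2 * BX) ^ 2) + 3 * variation f T) := by
  set K₀ := N * Bg * (2 * BX) + N * L * (2 * BX) ^ 2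
  let φ : ℕ → ℝ := fun t => globalCost f t (average (x t))
  let v : ℕ → ℝ := fun t => ⨆ z, |globalCost f (t + 1) z - globalCost f t z|
  have hv : ∀ t ∈ Finset.Ico 1 T, φ (t + 1) - globalCost f t (average (x (t + 1))) ≤ v t :=
    fun t ht => (le_abs_self _).trans (abs_globalCost_succ_sub_le h.finiteVariation ht _)
  have hφ : ∀ t ∈ Finset.Icc 1 T, |φ t - φ 1| ≤ variation f T + K₀ :=
    fun t ht => h.abs_globalCost_average_sub_le hBX ht
  have hθ_nonneg : ∀ t, 1 ≤ t → 0 ≤ (η t)⁻¹ := fun t ht => (inv_pos.2 (h.stepSize_pos t ht)).le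
  have habel := sum_Ico_mul_sub_succ_le (K := φ 1 + (variation f T + K₀)) hT
    (hθ_nonneg 1 le_rfl) h.stepSize_inv_mono
    fun t ht => sub_le_iff_le_add'.1 ((le_abs_self _).trans (hφ t ht))
  calc _ ≤ ∑ t ∈ Finset.Ico 1 T, ((η t)⁻¹ * (φ t - φ (t + 1)) + (η T)⁻¹ * v t) := by
        refine Finset.sum_le_sum fun t ht => ?_
        have ht1 := (Finset.mem_Ico.1 ht).1
        have hvt : (η t)⁻¹ * v t ≤ (η T)⁻¹ * v t :=
          mul_le_mul_of_nonneg_right (h.stepSize_inv_mono ht1 hT (Finset.mem_Ico.1 ht).2.le)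
            (Real.iSup_nonneg fun _ => abs_nonneg _)
        have hdecrease := mul_le_mul_of_nonneg_left (hv t ht) (hθ_nonneg t ht1)
        linarith
    _ = ∑ t ∈ Finset.Ico 1 T, (η t)⁻¹ * (φ t - φ (t + 1)) + (η T)⁻¹ * variation f T := by
        rw [Finset.sum_add_distrib, ← Finset.mul_sum, variation_eq_sum_Ico]
    _ ≤ (η T)⁻¹ * (φ 1 + (variation f T + K₀) - φ T) + (η T)⁻¹ * variation f T :=
        add_le_add_left habel _
    _ = (η T)⁻¹ * (φ 1 + (variation f T + K₀) - φ T + variation f T) := by ring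
    _ ≤ _ := by
        refine mul_le_mul_of_nonneg_left ?_ (hθ_nonneg T hT)
        linarith [(abs_le.1 (hφ T (Finset.right_mem_Icc.2 hT))).1]

theorem sum_sq_norm_gradient_average_le (h : BoundedTrajectory T L BX Bg W η lam f x c)
    (hN : 1 ≤ N) (hBX : 0 ≤ BX) (hT : 1 ≤ T) :
    ∑ t ∈ Finset.Ico 1 T, ‖gradient (globalCost f t) (average (x t))‖ ^ 2
      ≤ N * (∑ t ∈ Finset.Ico 1 T, clipError f t (x t) (c t)
        + (η T)⁻¹ * (2 * (N * Bg * (2 * BX) + N * L * (2 * BX) ^ 2) + 3 * variation f T)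
        + N * L * ∑ t ∈ Finset.Ico 1 T, η t * lam t ^ 2
        + N * Bg * L * ∑ t ∈ Finset.Ico 1 T, disagreement (x t)) := by
  have hstep : ∀ t ∈ Finset.Ico 1 T,
      (N : ℝ)⁻¹ * ‖gradient (globalCost f t) (average (x t))‖ ^ 2
        ≤ clipError f t (x t) (c t)
          + (η t)⁻¹ * (globalCost f t (average (x t)) - globalCost f t (average (x (t + 1))))
          + N * L * (η t * lam t ^ 2) + N * Bg * L * disagreement (x t) := fun t ht => by
    have htT := Finset.Ico_subset_Icc_self ht
    linarith [sq_norm_gradient_average_le_inner_add (h.smooth t htT)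
      (h.norm_gradient_average_le t htT) (c t), h.inner_average_direction_le ht]
  rw [← inv_mul_le_iff₀ (by exact_mod_cast hN), Finset.mul_sum]
  refine (Finset.sum_le_sum hstep).trans ?_
  simp only [Finset.sum_add_distrib, ← Finset.mul_sum]
  gcongr
  exact h.sum_inv_mul_globalCost_sub_le hBX hT

theorem nreg_le (h : BoundedTrajectory T L BX Bg W η lam f x c)
    (hN : 1 ≤ N) (hBX : 0 ≤ BX) (hBg : 0 ≤ Bg) (hT : 1 ≤ T) :
    nreg f x T ≤ 2 * N ^ 2 * (∑ t ∈ Finset.Ico 1 T, clipError f t (x t) (c t)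
        + (η T)⁻¹ * (2 * (N * Bg * (2 * BX) + N * L * (2 * BX) ^ 2) + 3 * variation f T)
        + N * L * ∑ t ∈ Finset.Ico 1 T, η t * lam t ^ 2)
      + (2 * N ^ 3 * Bg * L + 4 * N * (N * L) ^ 2 * BX) * ∑ t ∈ Finset.Icc 1 T, disagreement (x t)
      + 2 * N * (N * Bg) ^ 2 := by
  have hlocal : nreg f x T
      ≤ 2 * N * ∑ t ∈ Finset.Icc 1 T, ‖gradient (globalCost f t) (average (x t))‖ ^ 2
        + 4 * N * (N * L) ^ 2 * BX * ∑ t ∈ Finset.Icc 1 T, disagreement (x t) := by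
    rw [Finset.mul_sum, Finset.mul_sum, ← Finset.sum_add_distrib]
    exact Finset.sum_le_sum fun t ht =>
      sum_sq_norm_gradient_le (h.smooth t ht) hBX (h.norm_state_le t ht)
  have hlast : ‖gradient (globalCost f T) (average (x T))‖ ^ 2 ≤ (N * Bg) ^ 2 := by
    gcongr
    exact h.norm_gradient_average_globalCost_le (Finset.right_mem_Icc.2 hT)
  have hsplit : ∑ t ∈ Finset.Icc 1 T, ‖gradient (globalCost f t) (average (x t))‖ ^ 2
      = ∑ t ∈ Finset.Ico 1 T, ‖gradient (globalCost f t) (average (x t))‖ ^ 2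
        + ‖gradient (globalCost f T) (average (x T))‖ ^ 2 := by
    rw [← Finset.Ico_add_one_right_eq_Icc, Finset.sum_Ico_succ_top hT]
  have hdis : N * Bg * L * ∑ t ∈ Finset.Ico 1 T, disagreement (x t)
      ≤ N * Bg * L * ∑ t ∈ Finset.Icc 1 T, disagreement (x t) := by
    gcongr
    · exact fun t _ _ => disagreement_nonneg (x t)
    · exact Finset.Ico_subset_Icc_self
  have haverage := h.sum_sq_norm_gradient_average_le hN hBX hT
  rw [hsplit] at hlocal
  calc nreg f x T ≤ _ := hlocal
    _ ≤ 2 * N * (N * (∑ t ∈ Finset.Ico 1 T, clipError f t (x t) (c t)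
        + (η T)⁻¹ * (2 * (N * Bg * (2 * BX) + N * L * (2 * BX) ^ 2) + 3 * variation f T)
        + N * L * ∑ t ∈ Finset.Ico 1 T, η t * lam t ^ 2
        + N * Bg * L * ∑ t ∈ Finset.Icc 1 T, disagreement (x t)) + (N * Bg) ^ 2)
        + 4 * N * (N * L) ^ 2 * BX * ∑ t ∈ Finset.Icc 1 T, disagreement (x t) := by
        gcongr
        exact haverage.trans (by gcongr)
    _ = _ := by ring

theorem sum_disagreement_le (h : BoundedTrajectory T L BX Bg W η lam f x c)
    {w : ℝ} {B : ℕ} {edge : ℕ → Fin N → Fin N → Prop} (hW : NetworkAssumption w B edge W)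
    (hw : 0 < w) (hN : 1 ≤ N) (hBX : 0 ≤ BX) :
    w ^ (N * B) * ∑ t ∈ Finset.Icc 1 T, disagreement (x t)
      ≤ (N * B : ℕ) * (2 * BX + 2 * ∑ t ∈ Finset.Ico 1 T, η t * lam t) :=
  hW.sum_disagreement_le hw hN
    (fun t ht => mul_nonneg (h.stepSize_pos t ht).le (h.level_nonneg t))
    (fun t ht i => by
      have hη := (h.stepSize_pos t (Finset.mem_Ico.1 ht).1).le
      rw [h.step t ht, sub_sub_cancel_left, norm_neg, norm_smul, Real.norm_of_nonneg hη]
      exact mul_le_mul_of_nonneg_left (h.norm_direction_le t i) hη) hBX h.norm_state_le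

end BoundedTrajectory

end Trajectory

/-! ### Clipping -/

section Clip

variable {d : ℕ} {lam : ℝ}

theorem norm_clip_le (hlam : 0 ≤ lam) (y : Vec d) : ‖clip lam y‖ ≤ lam := by
  rcases eq_or_ne y 0 with rfl | hy
  · simpa [clip] using hlam
  · rw [clip, norm_smul, Real.norm_of_nonneg (le_min zero_le_one (by positivity)),
      ← le_div_iff₀ (norm_pos_iff.2 hy)]
    exact min_le_right _ _

theorem clip_of_norm_le {y : Vec d} (hy : ‖y‖ ≤ lam) : clip lam y = y := by
  rcases eq_or_ne y 0 with rfl | hy0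
  · exact smul_zero _
  · rw [clip, min_eq_left ((one_le_div (norm_pos_iff.2 hy0)).2 hy), one_smul]

theorem norm_sub_clip_of_le_norm (hlam : 0 < lam) {y : Vec d} (hy : lam ≤ ‖y‖) :
    ‖y - clip lam y‖ = ‖y‖ - lam := by
  have hy0 : 0 < ‖y‖ := hlam.trans_le hy
  have hratio : lam / ‖y‖ ≤ 1 := (div_le_one hy0).2 hy
  calc ‖y - clip lam y‖ = ‖(1 - lam / ‖y‖) • y‖ := by
        rw [clip, min_eq_right hratio, sub_smul, one_smul]
    _ = ‖y‖ - lam := by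
        rw [norm_smul, Real.norm_of_nonneg (sub_nonneg.2 hratio), sub_mul, one_mul,
          div_mul_cancel₀ _ hy0.ne']

theorem norm_sub_clip_le (hlam : 0 < lam) {p : ℝ} (hp : 1 ≤ p) {m : Vec d} (hm : ‖m‖ ≤ lam / 2)
    (y : Vec d) : ‖y - clip lam y‖ ≤ (lam / 2) ^ (1 - p) * ‖y - m‖ ^ p := by
  rcases le_total ‖y‖ lam with hy | hy
  · rw [clip_of_norm_le hy, sub_self, norm_zero]
    positivity
  · have htriangle : ‖y‖ ≤ ‖y - m‖ + ‖m‖ := by simpa using norm_add_le (y - m) m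
    have hdist : lam / 2 ≤ ‖y - m‖ := by linarith
    calc ‖y - clip lam y‖ ≤ ‖y - m‖ := by rw [norm_sub_clip_of_le_norm hlam hy]; linarith
      _ = ‖y - m‖ ^ (1 - p) * ‖y - m‖ ^ p := by
          rw [← Real.rpow_add (by linarith), sub_add_cancel, Real.rpow_one]
      _ ≤ _ := by
          gcongr ?_ * _
          exact Real.rpow_le_rpow_of_nonpos (by linarith) hdist (by linarith)

theorem measurable_clip : Measurable (clip (d := d) lam) :=
  (measurable_const.min (measurable_const.div measurable_norm)).smul measurable_id

end Clip

/-! ### A tail bound for sums of bounded variables with small conditional drift -/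

section Drift

variable {Ω : Type*} {m m0 : MeasurableSpace Ω} {μ : Measure Ω}

theorem exp_mul_le_of_abs_le {s K y : ℝ} (hs : 0 ≤ s) (hy : |y| ≤ K) (hsK : s * K ≤ 1) :
    Real.exp (s * y) ≤ s * y + (1 + s ^ 2 * K ^ 2) := by
  have hsy : |s * y| ≤ 1 := by
    rw [abs_mul, abs_of_nonneg hs]
    exact (mul_le_mul_of_nonneg_left hy hs).trans hsK
  have htaylor := (abs_le.1 (Real.abs_exp_sub_one_sub_id_le hsy)).2
  have hsq : (s * y) ^ 2 ≤ s ^ 2 * K ^ 2 := by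
    rw [mul_pow]
    exact mul_le_mul_of_nonneg_left (sq_le_sq.2 (hy.trans (le_abs_self K))) (sq_nonneg s)
  linarith

theorem integrable_exp_mul_of_abs_le [IsFiniteMeasure μ] {y : Ω → ℝ} {s K : ℝ} (hs : 0 ≤ s)
    (hy : AEStronglyMeasurable y μ) (hyK : ∀ᵐ ω ∂μ, |y ω| ≤ K) :
    Integrable (fun ω => Real.exp (s * y ω)) μ := by
  refine Integrable.of_bound
    (Real.continuous_exp.comp_aestronglyMeasurable (hy.const_mul s)) (Real.exp (s * K)) ?_
  filter_upwards [hyK] with ω hω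
  rw [Real.norm_of_nonneg (Real.exp_nonneg _)]
  exact Real.exp_le_exp.2 (mul_le_mul_of_nonneg_left ((le_abs_self _).trans hω) hs)

theorem condExp_exp_mul_le [IsFiniteMeasure μ] (hm : m ≤ m0) {y : Ω → ℝ} {s K β : ℝ}
    (hs : 0 ≤ s) (hsK : s * K ≤ 1) (hy : AEStronglyMeasurable y μ)
    (hyK : ∀ᵐ ω ∂μ, |y ω| ≤ K) (hβ : μ[y | m] ≤ᵐ[μ] fun _ => β) :
    μ[fun ω => Real.exp (s * y ω) | m] ≤ᵐ[μ] fun _ => Real.exp (s * β + s ^ 2 * K ^ 2) := by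
  have hyi : Integrable y μ := Integrable.of_bound hy K hyK
  have hmono := condExp_mono (m := m) (integrable_exp_mul_of_abs_le hs hy hyK)
    ((hyi.smul s).add (integrable_const (1 + s ^ 2 * K ^ 2)))
    (hyK.mono fun ω hω => exp_mul_le_of_abs_le hs hω hsK)
  filter_upwards [hmono, condExp_add (hyi.smul s) (integrable_const (1 + s ^ 2 * K ^ 2)) m,
    condExp_smul s y m, hβ] with ω hω hadd hsmul hβω
  rw [hadd, Pi.add_apply, hsmul, condExp_const hm] at hω
  calc _ ≤ s * μ[y | m] ω + (1 + s ^ 2 * K ^ 2) := hω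
    _ ≤ s * β + s ^ 2 * K ^ 2 + 1 := by linarith [mul_le_mul_of_nonneg_left hβω hs]
    _ ≤ _ := Real.add_one_le_exp _

theorem integral_mul_le_of_condExp_le (hm : m ≤ m0) [SigmaFinite (μ.trim hm)] {Z F : Ω → ℝ}
    {c : ℝ} (hZm : StronglyMeasurable[m] Z) (hZ0 : ∀ ω, 0 ≤ Z ω) (hZ : Integrable Z μ)
    (hF : Integrable F μ) (hZF : Integrable (Z * F) μ) (hc : μ[F | m] ≤ᵐ[μ] fun _ => c) :
    ∫ ω, Z ω * F ω ∂μ ≤ c * ∫ ω, Z ω ∂μ := by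
  have hpull := condExp_mul_of_stronglyMeasurable_left hZm hZF hF
  calc ∫ ω, (Z * F) ω ∂μ = ∫ ω, (Z * μ[F | m]) ω ∂μ := by
        rw [← integral_condExp hm, integral_congr_ae hpull]
    _ ≤ ∫ ω, c * Z ω ∂μ := by
        refine integral_mono_ae (integrable_condExp.congr hpull) (hZ.const_mul c) ?_
        filter_upwards [hc] with ω hω
        rw [mul_comm c]
        exact mul_le_mul_of_nonneg_left hω (hZ0 ω)
    _ = c * ∫ ω, Z ω ∂μ := integral_const_mul _ _

/-- The random variables `y t`, `k ≤ t < n`, are bounded by `K t` and have conditional mean at most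
`β t` given `ℱ t`, where `ℱ t` contains the information on the earlier variables. The σ-algebras
need not form a filtration outside this range. -/
structure BoundedDrift (μ : Measure Ω) (ℱ : ℕ → MeasurableSpace Ω) (k n : ℕ) (y : ℕ → Ω → ℝ)
    (K β : ℕ → ℝ) : Prop where
  le : ∀ t ∈ Finset.Ico k n, ℱ t ≤ m0
  measurable : ∀ t ∈ Finset.Ico k n, Measurable (y t)
  measurable_past : ∀ t ∈ Finset.Ico k n, ∀ r ∈ Finset.Ico k t, Measurable[ℱ t] (y r)
  abs_le : ∀ t ∈ Finset.Ico k n, ∀ᵐ ω ∂μ, |y t ω| ≤ K t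
  condExp_le : ∀ t ∈ Finset.Ico k n, μ[y t | ℱ t] ≤ᵐ[μ] fun _ => β t

namespace BoundedDrift

variable {ℱ : ℕ → MeasurableSpace Ω} {k n l : ℕ} {y : ℕ → Ω → ℝ} {K β : ℕ → ℝ} {s : ℝ}

theorem mono (h : BoundedDrift μ ℱ k n y K β) (hl : l ≤ n) : BoundedDrift μ ℱ k l y K β :=
  have hsub := Finset.Ico_subset_Ico_right hl
  ⟨fun t ht => h.le t (hsub ht), fun t ht => h.measurable t (hsub ht),
    fun t ht => h.measurable_past t (hsub ht), fun t ht => h.abs_le t (hsub ht),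
    fun t ht => h.condExp_le t (hsub ht)⟩

theorem measurable_sum (h : BoundedDrift μ ℱ k n y K β) :
    Measurable fun ω => ∑ t ∈ Finset.Ico k n, y t ω :=
  Finset.measurable_fun_sum _ h.measurable

theorem ae_abs_sum_le (h : BoundedDrift μ ℱ k n y K β) :
    ∀ᵐ ω ∂μ, |∑ t ∈ Finset.Ico k n, y t ω| ≤ ∑ t ∈ Finset.Ico k n, K t := by
  filter_upwards [(Finset.eventually_all _).2 h.abs_le] with ω hω
  exact (Finset.abs_sum_le_sum_abs _ _).trans (Finset.sum_le_sum hω)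

variable [IsProbabilityMeasure μ]

theorem integrable_exp_mul_sum (h : BoundedDrift μ ℱ k n y K β) (hs : 0 ≤ s) :
    Integrable (fun ω => Real.exp (s * ∑ t ∈ Finset.Ico k n, y t ω)) μ :=
  integrable_exp_mul_of_abs_le hs h.measurable_sum.aestronglyMeasurable h.ae_abs_sum_le

theorem integral_exp_mul_sum_le (h : BoundedDrift μ ℱ k n y K β) (hkn : k ≤ n) (hs : 0 ≤ s)
    (hsK : ∀ t ∈ Finset.Ico k n, s * K t ≤ 1) :
    ∫ ω, Real.exp (s * ∑ t ∈ Finset.Ico k n, y t ω) ∂μ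
      ≤ Real.exp (∑ t ∈ Finset.Ico k n, (s * β t + s ^ 2 * K t ^ 2)) := by
  induction n, hkn using Nat.le_induction with
  | base => simp
  | succ n hkn ih =>
    have hprev := h.mono n.le_succ
    have hn : n ∈ Finset.Ico k (n + 1) := Finset.mem_Ico.2 ⟨hkn, n.lt_succ_self⟩
    have hexp : ∀ ω, Real.exp (s * ∑ t ∈ Finset.Ico k (n + 1), y t ω)
        = Real.exp (s * ∑ t ∈ Finset.Ico k n, y t ω) * Real.exp (s * y n ω) := fun ω => by
      rw [Finset.sum_Ico_succ_top hkn, mul_add, Real.exp_add]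
    have hZF := (h.integrable_exp_mul_sum hs).congr (ae_of_all _ hexp)
    have hyn := (h.measurable n hn).aestronglyMeasurable (μ := μ)
    have hpast : Measurable[ℱ n] fun ω => Real.exp (s * ∑ t ∈ Finset.Ico k n, y t ω) :=
      ((Finset.measurable_fun_sum _ (h.measurable_past n hn)).const_mul s).exp
    simp only [hexp]
    calc _ ≤ Real.exp (s * β n + s ^ 2 * K n ^ 2)
          * ∫ ω, Real.exp (s * ∑ t ∈ Finset.Ico k n, y t ω) ∂μ :=
          integral_mul_le_of_condExp_le (h.le n hn) hpast.stronglyMeasurable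
            (fun ω => Real.exp_nonneg _) (hprev.integrable_exp_mul_sum hs)
            (integrable_exp_mul_of_abs_le hs hyn (h.abs_le n hn)) hZF
            (condExp_exp_mul_le (h.le n hn) hs (hsK n hn) hyn (h.abs_le n hn) (h.condExp_le n hn))
      _ ≤ Real.exp (s * β n + s ^ 2 * K n ^ 2)
          * Real.exp (∑ t ∈ Finset.Ico k n, (s * β t + s ^ 2 * K t ^ 2)) := by
          gcongr
          exact ih hprev fun t ht => hsK t (Finset.Ico_subset_Ico_right n.le_succ ht)
      _ = _ := by rw [Finset.sum_Ico_succ_top hkn, ← Real.exp_add, add_comm]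

theorem measure_sum_ge_le (h : BoundedDrift μ ℱ k n y K β) (hkn : k ≤ n) (hs : 0 < s)
    (hsK : ∀ t ∈ Finset.Ico k n, s * K t ≤ 1) {δ : ℝ} (hδ : 0 < δ) :
    μ.real {ω | ∑ t ∈ Finset.Ico k n, β t + s * ∑ t ∈ Finset.Ico k n, K t ^ 2
      + Real.log (1 / δ) / s ≤ ∑ t ∈ Finset.Ico k n, y t ω} ≤ δ := by
  set ε := ∑ t ∈ Finset.Ico k n, β t + s * ∑ t ∈ Finset.Ico k n, K t ^ 2 + Real.log (1 / δ) / s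
    with hε
  calc μ.real {ω | ε ≤ ∑ t ∈ Finset.Ico k n, y t ω}
      ≤ Real.exp (-s * ε) * ∫ ω, Real.exp (s * ∑ t ∈ Finset.Ico k n, y t ω) ∂μ :=
        measure_ge_le_exp_mul_mgf ε hs.le (h.integrable_exp_mul_sum hs.le)
    _ ≤ Real.exp (-s * ε) * Real.exp (∑ t ∈ Finset.Ico k n, (s * β t + s ^ 2 * K t ^ 2)) := by
        gcongr
        exact h.integral_exp_mul_sum_le hkn hs.le hsK
    _ = Real.exp (Real.log δ) := by
        rw [← Real.exp_add, hε, Finset.sum_add_distrib, ← Finset.mul_sum, ← Finset.mul_sum,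
          one_div, Real.log_inv]
        congr 1
        field_simp
        ring
    _ = δ := Real.exp_log hδ

end BoundedDrift

end Drift

/-! ### Conditional drift of clipped unbiased estimators -/

section ClippedDrift

variable {d : ℕ} {Ω : Type*} {m m0 : MeasurableSpace Ω} {μ : Measure Ω}
  {u G γ : Ω → Vec d} {lam U p c : ℝ}

theorem integrable_inner_of_norm_le (hu : AEStronglyMeasurable u μ) (huU : ∀ᵐ ω ∂μ, ‖u ω‖ ≤ U)
    (hG : Integrable G μ) : Integrable (fun ω => inner ℝ (u ω) (G ω)) μ :=
  (innerSL ℝ).integrable_of_bilin_of_bdd_left U hu huU hG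

theorem condExp_inner_average_le {N : ℕ} {v : Fin N → Ω → Vec d}
    (hv : ∀ i, Integrable (fun ω => inner ℝ (u ω) (v i ω)) μ) (hc : 0 ≤ c)
    (hvc : ∀ i, μ[fun ω => inner ℝ (u ω) (v i ω) | m] ≤ᵐ[μ] fun _ => c) :
    μ[fun ω => inner ℝ (u ω) (average fun i => v i ω) | m] ≤ᵐ[μ] fun _ => c := by
  have haverage : (fun ω => inner ℝ (u ω) (average fun i => v i ω))
      = (N : ℝ)⁻¹ • ∑ i, fun ω => inner ℝ (u ω) (v i ω) := by
    ext ω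
    rw [inner_average, Pi.smul_apply, Finset.sum_apply, smul_eq_mul]
  rw [haverage]
  filter_upwards [condExp_smul (N : ℝ)⁻¹ (∑ i, fun ω => inner ℝ (u ω) (v i ω)) m,
    condExp_finsetSum (s := Finset.univ) (fun i _ => hv i) m, ae_all_iff.2 hvc]
    with ω hsmul hsum hω
  rw [hsmul, Pi.smul_apply, hsum, Finset.sum_apply, smul_eq_mul]
  refine inv_mul_le_of_le_mul₀ N.cast_nonneg hc ((Finset.sum_le_sum fun i _ => hω i).trans_eq ?_)
  simp

variable [IsFiniteMeasure μ]

theorem condExp_inner_condExp_sub (hm : m ≤ m0) (hu : StronglyMeasurable[m] u)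
    (huU : ∀ᵐ ω ∂μ, ‖u ω‖ ≤ U) (hG : Integrable G μ) (hγ : μ[G | m] =ᵐ[μ] γ) :
    μ[fun ω => inner ℝ (u ω) (γ ω - G ω) | m] =ᵐ[μ] 0 := by
  have hγi : Integrable γ μ := integrable_condExp.congr hγ
  have hproj : μ[γ | m] =ᵐ[μ] μ[G | m] := (condExp_congr_ae hγ.symm).trans <| by
    rw [condExp_of_stronglyMeasurable hm stronglyMeasurable_condExp integrable_condExp]
  have hpull : μ[fun ω => inner ℝ (u ω) (γ ω - G ω) | m]
      =ᵐ[μ] fun ω => inner ℝ (u ω) (μ[γ - G | m] ω) :=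
    condExp_stronglyMeasurable_bilin_of_bound (innerSL ℝ) hm hu (hγi.sub hG) U huU
  filter_upwards [hpull, condExp_sub hγi hG m, hproj] with ω hω hsub heq
  rw [hω, hsub, Pi.sub_apply, heq, sub_self, inner_zero_right, Pi.zero_apply]

theorem inner_sub_clip_le (hlam : 0 < lam) (hp : 1 ≤ p) {u y m : Vec d} (hu : ‖u‖ ≤ U)
    (hm : ‖m‖ ≤ lam / 2) :
    inner ℝ u (m - clip lam y)
      ≤ inner ℝ u (m - y) + U * (lam / 2) ^ (1 - p) * ‖y - m‖ ^ p :=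
  calc inner ℝ u (m - clip lam y) = inner ℝ u (m - y) + inner ℝ u (y - clip lam y) := by
        rw [← inner_add_right, sub_add_sub_cancel]
    _ ≤ inner ℝ u (m - y) + U * ((lam / 2) ^ (1 - p) * ‖y - m‖ ^ p) := by
        gcongr
        exact (real_inner_le_norm _ _).trans
          (mul_le_mul hu (norm_sub_clip_le hlam hp hm y) (norm_nonneg _)
            ((norm_nonneg u).trans hu))
    _ = _ := by rw [mul_assoc]

theorem integrable_clip (hlam : 0 ≤ lam) (hG : AEStronglyMeasurable G μ) :
    Integrable (fun ω => clip lam (G ω)) μ :=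
  Integrable.of_bound (measurable_clip.comp_aemeasurable hG.aemeasurable).aestronglyMeasurable
    lam (ae_of_all _ fun _ => norm_clip_le hlam _)

theorem condExp_inner_sub_clip_le (hm : m ≤ m0) (hlam : 0 < lam) (hp : 1 ≤ p) (hU : 0 ≤ U)
    (hu : StronglyMeasurable[m] u) (huU : ∀ᵐ ω ∂μ, ‖u ω‖ ≤ U) (hG : Integrable G μ)
    (hγ : μ[G | m] =ᵐ[μ] γ) (hγb : ∀ᵐ ω ∂μ, ‖γ ω‖ ≤ lam / 2)
    (hn : Integrable (fun ω => ‖G ω - γ ω‖ ^ p) μ)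
    (hc : μ[fun ω => ‖G ω - γ ω‖ ^ p | m] ≤ᵐ[μ] fun _ => c) :
    μ[fun ω => inner ℝ (u ω) (γ ω - clip lam (G ω)) | m]
      ≤ᵐ[μ] fun _ => U * (lam / 2) ^ (1 - p) * c := by
  have hγi : Integrable γ μ := integrable_condExp.congr hγ
  have hu0 := (hu.mono hm).aestronglyMeasurable (μ := μ)
  have hclip := integrable_inner_of_norm_le hu0 huU (hγi.sub (integrable_clip hlam.le hG.1))
  have hnoise := integrable_inner_of_norm_le hu0 huU (hγi.sub hG)
  have hmoment := hn.smul (U * (lam / 2) ^ (1 - p))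
  have hmono := condExp_mono (m := m) hclip (hnoise.add hmoment) <| by
    filter_upwards [huU, hγb] with ω huω hγω using inner_sub_clip_le hlam hp huω hγω
  filter_upwards [hmono, condExp_add hnoise hmoment m, condExp_inner_condExp_sub hm hu huU hG hγ,
    condExp_smul (U * (lam / 2) ^ (1 - p)) (fun ω => ‖G ω - γ ω‖ ^ p) m, hc]
    with ω hω hadd hzero hsmul hcω
  have hzero' : μ[fun ω => inner ℝ (u ω) ((γ - G) ω) | m] ω = 0 := hzero
  refine hω.trans ?_
  rw [hadd, Pi.add_apply, hzero', zero_add, hsmul]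
  exact mul_le_mul_of_nonneg_left hcω (by positivity)

end ClippedDrift

/-! ### Clipped descent -/

section History

variable {N d : ℕ} {Ω : Type*} {x₁ : Fin N → Ω → Vec d} {G : Fin N → ℕ → Ω → Vec d} {s t : ℕ}

theorem history_le [m0 : MeasurableSpace Ω] (hx : ∀ i, Measurable (x₁ i))
    (hG : ∀ s ∈ Finset.Ico 1 t, ∀ i, Measurable (G i s)) : history x₁ G t ≤ m0 :=
  sup_le (iSup_le fun i => (hx i).comap_le)
    (iSup₂_le fun s hs => iSup_le fun i => (hG s hs i).comap_le)

theorem measurable_history_init (i : Fin N) : Measurable[history x₁ G t] (x₁ i) :=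
  (comap_measurable _).mono
    ((le_iSup (fun j => MeasurableSpace.comap (x₁ j) inferInstance) i).trans le_sup_left) le_rfl

theorem measurable_history_observed (hs : s ∈ Finset.Ico 1 t) (i : Fin N) :
    Measurable[history x₁ G t] (G i s) :=
  (comap_measurable _).mono
    (((le_iSup (fun j => MeasurableSpace.comap (G j s) inferInstance) i).trans
      (le_iSup₂ (f := fun s (_ : s ∈ Finset.Ico 1 t) =>
        ⨆ j, MeasurableSpace.comap (G j s) inferInstance) s hs)).trans le_sup_right) le_rfl

theorem randomStates_succ {W : ℕ → Matrix (Fin N) (Fin N) ℝ} {η lam : ℕ → ℝ}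
    {g : Fin N → ℕ → Ω → Vec d → Vec d} {X : ℕ → Fin N → Ω → Vec d}
    (hX : X = randomStates W η lam x₁ g) (hG : G = observed g X) (ht : 1 ≤ t) (i : Fin N) (ω : Ω) :
    X (t + 1) i ω = ∑ j, W t i j • X t j ω - η t • clip (lam t) (G i t ω) := by
  obtain ⟨r, rfl⟩ := Nat.exists_eq_add_of_le' ht
  rw [hG, hX]
  rfl

end History

section ClipErrorBounds

variable {N d t : ℕ} {L : ℝ≥0} {f : Fin N → ℕ → Vec d → ℝ}

theorem LSmooth.measurable_gradient {h : Vec d → ℝ} (hh : LSmooth L h) :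
    Measurable (gradient h) :=
  hh.2.continuous.measurable

theorem measurable_average {Ω : Type*} {_ : MeasurableSpace Ω} {x : Fin N → Ω → Vec d}
    (hx : ∀ i, Measurable (x i)) : Measurable fun ω => average fun i => x i ω := by
  unfold average
  fun_prop

theorem measurable_gradient_globalCost_average {Ω : Type*} {_ : MeasurableSpace Ω}
    {x : Fin N → Ω → Vec d} (hf : ∀ i, LSmooth L (f i t)) (hx : ∀ i, Measurable (x i)) :
    Measurable fun ω => gradient (globalCost f t) (average fun i => x i ω) :=
  (LSmooth.globalCost hf).measurable_gradient.comp (measurable_average hx)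

theorem measurable_clipError {Ω : Type*} {_ : MeasurableSpace Ω} {x c : Fin N → Ω → Vec d}
    (hf : ∀ i, LSmooth L (f i t)) (hx : ∀ i, Measurable (x i)) (hc : ∀ i, Measurable (c i)) :
    Measurable fun ω => clipError f t (fun i => x i ω) fun i => c i ω :=
  (measurable_gradient_globalCost_average hf hx).inner (measurable_average fun i =>
    ((hf i).measurable_gradient.comp (hx i)).sub (hc i))

theorem abs_clipError_le {x c : Fin N → Vec d} {Bg lam : ℝ} (hBg : 0 ≤ Bg) (hlam : 0 ≤ lam)
    (hf : ∀ i, Differentiable ℝ (f i t)) (hg : ∀ i, ‖gradient (f i t) (x i)‖ ≤ Bg)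
    (hg' : ∀ i, ‖gradient (f i t) (average x)‖ ≤ Bg) (hc : ∀ i, ‖c i‖ ≤ lam) :
    |clipError f t x c| ≤ N * Bg * (Bg + lam) :=
  (abs_real_inner_le_norm _ _).trans <|
    mul_le_mul (norm_gradient_globalCost_le hf hg')
      (norm_average_le (by positivity) fun i => norm_sub_le_of_le (hg i) (hc i))
      (norm_nonneg _) (by positivity)

end ClipErrorBounds

/-- Decentralised clipped descent with random states `X` and observed gradients `G`, together with
the assumptions on the costs and on the noise. The gradient estimators enter only through their
observed values. -/
structure ClippedDescent {N d : ℕ} {Ω : Type*} [MeasurableSpace Ω] (μ : Measure Ω) (T : ℕ)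
    (L : ℝ≥0) (p σ BX Bg : ℝ) (W : ℕ → Matrix (Fin N) (Fin N) ℝ) (η lam : ℕ → ℝ)
    (f : Fin N → ℕ → Vec d → ℝ) (x₁ : Fin N → Ω → Vec d) (X : ℕ → Fin N → Ω → Vec d)
    (G : Fin N → ℕ → Ω → Vec d) : Prop where
  init : X 1 = x₁
  succ : ∀ t, 1 ≤ t → ∀ i ω,
    X (t + 1) i ω = ∑ j, W t i j • X t j ω - η t • clip (lam t) (G i t ω)
  measurable_init : ∀ i, Measurable (x₁ i)
  measurable_observed : ∀ i, ∀ t ∈ Finset.Icc 1 T, Measurable (G i t)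
  smooth : ∀ i, ∀ t ∈ Finset.Icc 1 T, LSmooth L (f i t)
  unbiased : Unbiased μ T f x₁ X G
  heavyTailed : HeavyTailed μ T p σ f x₁ X G
  boundedStates : BoundedStates μ T BX Bg f X

namespace ClippedDescent

variable {N d T : ℕ} {Ω : Type*} [m0 : MeasurableSpace Ω] {μ : Measure Ω} {L : ℝ≥0}
  {p σ BX Bg : ℝ} {W : ℕ → Matrix (Fin N) (Fin N) ℝ} {η lam : ℕ → ℝ} {f : Fin N → ℕ → Vec d → ℝ}
  {x₁ : Fin N → Ω → Vec d} {X : ℕ → Fin N → Ω → Vec d} {G : Fin N → ℕ → Ω → Vec d} {r t : ℕ}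

theorem measurable_states (h : ClippedDescent μ T L p σ BX Bg W η lam f x₁ X G) (hr : 1 ≤ r)
    (hrt : r ≤ t) (i : Fin N) : Measurable[history x₁ G t] (X r i) := by
  induction r, hr using Nat.le_induction generalizing i with
  | base => exact h.init ▸ measurable_history_init i
  | succ r hr ih =>
    rw [funext (h.succ r hr i)]
    have hobserved := measurable_history_observed (x₁ := x₁) (G := G)
      (Finset.mem_Ico.2 ⟨hr, hrt⟩) i
    let := history x₁ G t
    exact (Finset.measurable_fun_sum _ fun j _ => (ih (by omega) j).const_smul (W r i j)).sub
      ((measurable_clip.comp hobserved).const_smul (η r))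

theorem history_le (h : ClippedDescent μ T L p σ BX Bg W η lam f x₁ X G) (ht : t ≤ T + 1) :
    history x₁ G t ≤ m0 :=
  ODCSGD.history_le h.measurable_init fun s hs i => h.measurable_observed i s <| by
    rw [Finset.mem_Ico] at hs
    exact Finset.mem_Icc.2 ⟨hs.1, by omega⟩

theorem measurable_clipError (h : ClippedDescent μ T L p σ BX Bg W η lam f x₁ X G)
    (hr : r ∈ Finset.Ico 1 t) (ht : t ≤ T + 1) : Measurable[history x₁ G t] fun ω =>
      clipError f r (fun i => X r i ω) fun i => clip (lam r) (G i r ω) := by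
  have hr' := Finset.mem_Ico.1 hr
  exact ODCSGD.measurable_clipError
    (fun i => h.smooth i r (Finset.mem_Icc.2 ⟨hr'.1, by omega⟩))
    (h.measurable_states hr'.1 hr'.2.le)
    fun i => measurable_clip.comp (measurable_history_observed hr i)

theorem ae_abs_clipError_le (h : ClippedDescent μ T L p σ BX Bg W η lam f x₁ X G) (hBg : 0 ≤ Bg)
    (ht : t ∈ Finset.Icc 1 T) (hlam : 0 ≤ lam t) :
    ∀ᵐ ω ∂μ, |clipError f t (fun i => X t i ω) fun i => clip (lam t) (G i t ω)|
      ≤ N * Bg * (Bg + lam t) := by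
  filter_upwards [h.boundedStates] with ω hω
  exact abs_clipError_le hBg hlam (fun i => (h.smooth i t ht).1) (fun i => (hω t ht i).2.1)
    (fun i => (hω t ht i).2.2) fun i => norm_clip_le hlam _

theorem ae_boundedTrajectory (h : ClippedDescent μ T L p σ BX Bg W η lam f x₁ X G)
    (hcol : ∀ t, 1 ≤ t → ∀ j, ∑ i, W t i j = 1) (hη : ∀ t, 1 ≤ t → 0 < η t)
    (hη_mono : MonotoneOn (fun t => (η t)⁻¹) (Set.Ici 1)) (hlam : ∀ t, 0 ≤ lam t)
    (hfin : FiniteVariation f T) :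
    ∀ᵐ ω ∂μ, BoundedTrajectory T L BX Bg W η lam f (fun t i => X t i ω)
      fun t i => clip (lam t) (G i t ω) := by
  filter_upwards [h.boundedStates] with ω hω
  exact
  { col_sum := fun t ht => hcol t (Finset.mem_Ico.1 ht).1
    step := fun t ht i => h.succ t (Finset.mem_Ico.1 ht).1 i ω
    stepSize_pos := hη
    stepSize_inv_mono := hη_mono
    level_nonneg := hlam
    norm_direction_le := fun t i => norm_clip_le (hlam t) _
    smooth := fun t ht i => h.smooth i t ht
    norm_state_le := fun t ht i => (hω t ht i).1
    norm_gradient_average_le := fun t ht i => (hω t ht i).2.2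
    finiteVariation := hfin }

variable [IsFiniteMeasure μ]

theorem condExp_clipError_le (h : ClippedDescent μ T L p σ BX Bg W η lam f x₁ X G) (hp : 1 ≤ p)
    (hσ : 0 ≤ σ) (hBg : 0 ≤ Bg) (ht : t ∈ Finset.Icc 1 T) (hlam0 : 0 < lam t)
    (hlam : 2 * Bg ≤ lam t) :
    μ[fun ω => clipError f t (fun i => X t i ω) fun i => clip (lam t) (G i t ω) | history x₁ G t]
      ≤ᵐ[μ] fun _ => N * Bg * (lam t / 2) ^ (1 - p) * σ ^ p := by
  have ht' := Finset.mem_Icc.1 ht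
  have hpast : history x₁ G t ≤ m0 := h.history_le (ht'.2.trans T.le_succ)
  have hu := (measurable_gradient_globalCost_average (fun i => h.smooth i t ht)
    (h.measurable_states ht'.1 le_rfl)).stronglyMeasurable
  have huU : ∀ᵐ ω ∂μ, ‖gradient (globalCost f t) (average fun i => X t i ω)‖ ≤ N * Bg := by
    filter_upwards [h.boundedStates] with ω hω
    exact norm_gradient_globalCost_le (fun i => (h.smooth i t ht).1) fun i => (hω t ht i).2.2
  refine condExp_inner_average_le (fun i => ?_) (by positivity) fun i => ?_
  · exact integrable_inner_of_norm_le (hu.mono hpast).aestronglyMeasurable huU <|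
      (integrable_condExp.congr (h.unbiased t ht i).2).sub
        (integrable_clip hlam0.le (h.unbiased t ht i).1.1)
  · refine condExp_inner_sub_clip_le hpast hlam0 hp (by positivity) hu huU (h.unbiased t ht i).1
      (h.unbiased t ht i).2 ?_ (h.heavyTailed t ht i).1 (h.heavyTailed t ht i).2
    filter_upwards [h.boundedStates] with ω hω
    linarith [(hω t ht i).2.1]

theorem boundedDrift_clipError (h : ClippedDescent μ T L p σ BX Bg W η lam f x₁ X G) (hp : 1 ≤ p)
    (hσ : 0 ≤ σ) (hBg : 0 < Bg) (hlam : ∀ t, 1 ≤ t → 2 * Bg ≤ lam t) :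
    BoundedDrift μ (history x₁ G) 1 T
      (fun t ω => clipError f t (fun i => X t i ω) fun i => clip (lam t) (G i t ω))
      (fun t => N * Bg * (Bg + lam t)) fun t => N * Bg * (lam t / 2) ^ (1 - p) * σ ^ p := by
  have hlam0 : ∀ t ∈ Finset.Ico 1 T, 0 < lam t := fun t ht => by
    linarith [hlam t (Finset.mem_Ico.1 ht).1]
  have hle : ∀ t ∈ Finset.Ico 1 T, t ≤ T := fun t ht => (Finset.mem_Ico.1 ht).2.le
  have hIcc : Finset.Ico 1 T ⊆ Finset.Icc 1 T := Finset.Ico_subset_Icc_self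
  exact
  { le := fun t ht => h.history_le ((hle t ht).trans T.le_succ)
    measurable := fun t ht => (h.measurable_clipError ht T.le_succ).mono (h.history_le T.le_succ)
      le_rfl
    measurable_past := fun t ht r hr => h.measurable_clipError hr ((hle t ht).trans T.le_succ)
    abs_le := fun t ht => h.ae_abs_clipError_le hBg.le (hIcc ht) (hlam0 t ht).le
    condExp_le := fun t ht => h.condExp_clipError_le hp hσ hBg.le (hIcc ht) (hlam0 t ht)
      (hlam t (Finset.mem_Ico.1 ht).1) }

end ClippedDescent

/-! ### Polynomial step sizes and clipping levels -/

section Rates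

variable {a b κ α Bg : ℝ}

theorem rpow_add_mul_rpow_sub_one_le (h0 : 0 ≤ κ) (h1 : κ ≤ 1) (n : ℕ) :
    (n : ℝ) ^ κ + κ * ((n + 1 : ℕ) : ℝ) ^ (κ - 1) ≤ ((n + 1 : ℕ) : ℝ) ^ κ := by
  set m : ℝ := ((n + 1 : ℕ) : ℝ) with hm
  have hm1 : (n : ℝ) = m - 1 := by rw [hm]; push_cast; ring
  have hm0 : 0 < m := by positivity
  have hratio : 1 + -(1 / m) = n / m := by rw [hm1]; field_simp; ring
  have hbernoulli : (1 + -(1 / m)) ^ κ ≤ 1 + κ * -(1 / m) :=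
    rpow_one_add_le_one_add_mul_self
      (neg_le_neg ((div_le_one hm0).2 (by linarith [n.cast_nonneg (α := ℝ)]))) h0 h1
  rw [hratio, Real.div_rpow n.cast_nonneg hm0.le, div_le_iff₀ (by positivity)] at hbernoulli
  rw [Real.rpow_sub_one hm0.ne']
  calc _ ≤ (1 + κ * -(1 / m)) * m ^ κ + κ * (m ^ κ / m) := by gcongr
    _ = m ^ κ := by ring

theorem sum_rpow_sub_one_le (h0 : 0 < κ) (h1 : κ ≤ 1) (T : ℕ) :
    ∑ t ∈ Finset.Icc 1 T, (t : ℝ) ^ (κ - 1) ≤ (T : ℝ) ^ κ / κ := by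
  rw [le_div_iff₀' h0]
  induction T with
  | zero => simp [h0.ne']
  | succ n ih =>
    rw [Finset.sum_Icc_succ_top (by omega), mul_add]
    exact (add_le_add_left ih _).trans (rpow_add_mul_rpow_sub_one_le h0.le h1 n)

theorem sum_Ico_le_of_le_rpow (h0 : 0 < κ) (h1 : κ ≤ 1) {u : ℕ → ℝ} {c : ℝ} (hc : 0 ≤ c) (T : ℕ)
    (hu : ∀ t, 1 ≤ t → u t ≤ c * (t : ℝ) ^ (κ - 1)) :
    ∑ t ∈ Finset.Ico 1 T, u t ≤ c / κ * (T : ℝ) ^ κ :=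
  calc ∑ t ∈ Finset.Ico 1 T, u t ≤ ∑ t ∈ Finset.Ico 1 T, c * (t : ℝ) ^ (κ - 1) :=
        Finset.sum_le_sum fun t ht => hu t (Finset.mem_Ico.1 ht).1
    _ ≤ ∑ t ∈ Finset.Icc 1 T, c * (t : ℝ) ^ (κ - 1) :=
        Finset.sum_le_sum_of_subset_of_nonneg Finset.Ico_subset_Icc_self
          fun t _ _ => by positivity
    _ ≤ c * ((T : ℝ) ^ κ / κ) := by
        rw [← Finset.mul_sum]
        exact mul_le_mul_of_nonneg_left (sum_rpow_sub_one_le h0 h1 T) hc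
    _ = _ := by ring

section StepSize

variable {t : ℕ}

theorem min_mul_le (ht : 1 ≤ t) : min a (a + b) * t ≤ a * t + b := by
  have ht' : (1 : ℝ) ≤ t := by exact_mod_cast ht
  rcases le_total 0 b with hb | hb
  · rw [min_eq_left (by linarith)]
    linarith
  · rw [min_eq_right (by linarith)]
    nlinarith

theorem affine_pos (ha : 0 < a) (hab : 0 < a + b) (ht : 1 ≤ t) : 0 < a * t + b :=
  (mul_pos (lt_min ha hab) (by positivity)).trans_le (min_mul_le ht)

theorem stepSize_pos (ha : 0 < a) (hab : 0 < a + b) (ht : 1 ≤ t) : 0 < stepSize a b κ t :=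
  one_div_pos.2 (Real.rpow_pos_of_pos (affine_pos ha hab ht) _)

theorem inv_stepSize_monotoneOn (ha : 0 < a) (hab : 0 < a + b) (hκ : 0 ≤ κ) :
    MonotoneOn (fun t => (stepSize a b κ t)⁻¹) (Set.Ici 1) := by
  intro s hs t _ hst
  simp only [stepSize, one_div, inv_inv]
  have hpos := affine_pos ha hab hs
  gcongr

theorem inv_stepSize_le (ha : 0 < a) (hab : 0 < a + b) (hκ : 0 ≤ κ) (ht : 1 ≤ t) :
    (stepSize a b κ t)⁻¹ ≤ (a + |b|) ^ κ * (t : ℝ) ^ κ := by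
  have ht' : (1 : ℝ) ≤ t := by exact_mod_cast ht
  have hpos := affine_pos ha hab ht
  rw [stepSize, one_div, inv_inv, ← Real.mul_rpow (by positivity) (by positivity)]
  gcongr
  nlinarith [le_abs_self b, abs_nonneg b]

theorem stepSize_le (ha : 0 < a) (hab : 0 < a + b) (hκ : 0 ≤ κ) (ht : 1 ≤ t) :
    stepSize a b κ t ≤ (min a (a + b)) ^ (-κ) * (t : ℝ) ^ (-κ) := by
  have hmin : 0 < min a (a + b) := lt_min ha hab
  have ht' : (0 : ℝ) < t := by exact_mod_cast ht
  rw [← Real.mul_rpow hmin.le ht'.le, Real.rpow_neg (by positivity), stepSize, one_div]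
  gcongr
  exact min_mul_le ht

end StepSize

section ClipLevel

variable {t : ℕ}

theorem clipLevel_nonneg (hBg : 0 ≤ Bg) (t : ℕ) : 0 ≤ clipLevel Bg α t := by
  unfold clipLevel
  positivity

theorem two_mul_le_clipLevel (hBg : 0 ≤ Bg) (hα : 0 ≤ α) (ht : 1 ≤ t) :
    2 * Bg ≤ clipLevel Bg α t :=
  le_mul_of_one_le_right (by positivity) (Real.one_le_rpow (by exact_mod_cast ht) hα)

theorem half_clipLevel_rpow (hBg : 0 ≤ Bg) (q : ℝ) (t : ℕ) :
    (clipLevel Bg α t / 2) ^ q = Bg ^ q * (t : ℝ) ^ (α * q) := by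
  have hhalf : clipLevel Bg α t / 2 = Bg * (t : ℝ) ^ α := by
    unfold clipLevel
    ring
  rw [hhalf, Real.mul_rpow hBg (by positivity), ← Real.rpow_mul t.cast_nonneg]

theorem add_clipLevel_le (hBg : 0 ≤ Bg) (hα : 0 ≤ α) (ht : 1 ≤ t) :
    Bg + clipLevel Bg α t ≤ 3 * Bg * (t : ℝ) ^ α := by
  have hone : Bg ≤ Bg * (t : ℝ) ^ α :=
    le_mul_of_one_le_right hBg (Real.one_le_rpow (by exact_mod_cast ht) hα)
  unfold clipLevel
  linarith

theorem add_clipLevel_le_of_le (hBg : 0 ≤ Bg) (hα : 0 ≤ α) (ht : 1 ≤ t) {T : ℕ} (htT : t ≤ T) :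
    Bg + clipLevel Bg α t ≤ 3 * Bg * (T : ℝ) ^ α :=
  (add_clipLevel_le hBg hα ht).trans (by gcongr)

theorem stepSize_mul_clipLevel_sq_le (ha : 0 < a) (hab : 0 < a + b) (hκ : 0 ≤ κ)
    (hακ : 2 * α = 2 * κ - 1) (ht : 1 ≤ t) :
    stepSize a b κ t * clipLevel Bg α t ^ 2
      ≤ 4 * Bg ^ 2 * (min a (a + b)) ^ (-κ) * (t : ℝ) ^ (κ - 1) := by
  have ht0 : (0 : ℝ) < t := by exact_mod_cast ht
  have hexp : κ - 1 = -κ + (α + α) := by linarith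
  calc stepSize a b κ t * clipLevel Bg α t ^ 2
      ≤ ((min a (a + b)) ^ (-κ) * (t : ℝ) ^ (-κ)) * clipLevel Bg α t ^ 2 :=
        mul_le_mul_of_nonneg_right (stepSize_le ha hab hκ ht) (sq_nonneg _)
    _ = _ := by
        rw [hexp, Real.rpow_add ht0, Real.rpow_add ht0, clipLevel]
        ring

theorem stepSize_mul_clipLevel_le (ha : 0 < a) (hab : 0 < a + b) (hBg : 0 ≤ Bg)
    (hκ : 1 / 2 ≤ κ) (hακ : 2 * α = 2 * κ - 1) (ht : 1 ≤ t) :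
    stepSize a b κ t * clipLevel Bg α t
      ≤ 2 * Bg * (min a (a + b)) ^ (-κ) * (t : ℝ) ^ (κ - 1) := by
  have ht1 : (1 : ℝ) ≤ t := by exact_mod_cast ht
  calc stepSize a b κ t * clipLevel Bg α t
      ≤ ((min a (a + b)) ^ (-κ) * (t : ℝ) ^ (-κ)) * clipLevel Bg α t :=
        mul_le_mul_of_nonneg_right (stepSize_le ha hab (by linarith) ht) (clipLevel_nonneg hBg t)
    _ = 2 * Bg * (min a (a + b)) ^ (-κ) * (t : ℝ) ^ (-κ + α) := by
        rw [clipLevel, Real.rpow_add (by linarith)]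
        ring
    _ ≤ _ := by
        gcongr
        linarith

theorem sum_sq_mul_add_clipLevel_le (hBg : 0 ≤ Bg) (hα : 0 ≤ α) (hακ : 2 * α = 2 * κ - 1) {c : ℝ}
    (hc : 0 ≤ c) {T : ℕ} (hT : 1 ≤ T) :
    ∑ t ∈ Finset.Ico 1 T, (c * (Bg + clipLevel Bg α t)) ^ 2 ≤ (c * (3 * Bg) * (T : ℝ) ^ κ) ^ 2 := by
  have hT0 : (0 : ℝ) < T := by exact_mod_cast hT
  have hterm : ∀ t ∈ Finset.Ico 1 T, (c * (Bg + clipLevel Bg α t)) ^ 2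
      ≤ (c * (3 * Bg * (T : ℝ) ^ α)) ^ 2 := fun t ht => by
    have ht' := Finset.mem_Ico.1 ht
    have hlevel := clipLevel_nonneg (α := α) hBg t
    gcongr
    exact add_clipLevel_le_of_le hBg hα ht'.1 ht'.2.le
  have hpow : T * ((T : ℝ) ^ α) ^ 2 = ((T : ℝ) ^ κ) ^ 2 := by
    have hexp : κ + κ = 1 + (α + α) := by linarith
    rw [sq, sq, ← Real.rpow_add hT0, ← Real.rpow_add hT0, hexp, Real.rpow_add hT0 1, Real.rpow_one]
  calc _ ≤ (T - 1 : ℕ) * (c * (3 * Bg * (T : ℝ) ^ α)) ^ 2 :=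
        (Finset.sum_le_sum hterm).trans_eq (by simp)
    _ ≤ T * (c * (3 * Bg * (T : ℝ) ^ α)) ^ 2 := by
        gcongr
        exact Nat.sub_le _ _
    _ = (c * (3 * Bg)) ^ 2 * (T * ((T : ℝ) ^ α) ^ 2) := by ring
    _ = _ := by rw [hpow]; ring

end ClipLevel

end Rates

/-! ### Regret and clipping errors at polynomial rates -/

section Assembly

variable {N : ℕ} {L : ℝ≥0} {p σ BX Bg w a b κ α : ℝ} {B : ℕ}

theorem exists_sum_disagreement_le (hN : 1 ≤ N) (hBX : 0 ≤ BX) (hBg : 0 ≤ Bg) (hw : 0 < w)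
    (ha : 0 < a) (hab : 0 < a + b) (hκ : 1 / 2 ≤ κ) (hκ1 : κ ≤ 1) (hακ : 2 * α = 2 * κ - 1) :
    ∃ C : ℝ, 0 ≤ C ∧ ∀ {d T : ℕ} {edge : ℕ → Fin N → Fin N → Prop}
      {W : ℕ → Matrix (Fin N) (Fin N) ℝ} {f : Fin N → ℕ → Vec d → ℝ} {x c : ℕ → Fin N → Vec d},
      1 ≤ T → NetworkAssumption w B edge W →
      BoundedTrajectory T L BX Bg W (stepSize a b κ) (clipLevel Bg α) f x c →
      ∑ t ∈ Finset.Icc 1 T, disagreement (x t) ≤ C * (T : ℝ) ^ κ := by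
  have hκ0 : 0 < κ := by linarith
  set E := 2 * Bg * (min a (a + b)) ^ (-κ)
  refine ⟨(N * B : ℕ) * (2 * BX + 2 * (E / κ)) / w ^ (N * B), by positivity, ?_⟩
  intro d T edge W f x c hT hW h
  have hP : 1 ≤ (T : ℝ) ^ κ := Real.one_le_rpow (by exact_mod_cast hT) hκ0.le
  have hforcing : ∑ t ∈ Finset.Ico 1 T, stepSize a b κ t * clipLevel Bg α t ≤ E / κ * T ^ κ :=
    sum_Ico_le_of_le_rpow hκ0 hκ1 (by positivity) T
      fun t ht => stepSize_mul_clipLevel_le ha hab hBg hκ hακ ht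
  have hinit : 2 * BX ≤ 2 * BX * (T : ℝ) ^ κ := le_mul_of_one_le_right (by positivity) hP
  rw [div_mul_eq_mul_div, le_div_iff₀' (by positivity), mul_assoc]
  refine (h.sum_disagreement_le hW hw hN hBX).trans ?_
  gcongr
  linarith

theorem exists_nreg_le (hN : 1 ≤ N) (hBX : 0 ≤ BX) (hBg : 0 ≤ Bg) (hw : 0 < w)
    (ha : 0 < a) (hab : 0 < a + b) (hκ : 1 / 2 ≤ κ) (hκ1 : κ ≤ 1) (hακ : 2 * α = 2 * κ - 1) :
    ∃ C : ℝ, 0 ≤ C ∧ ∀ {d T : ℕ} {edge : ℕ → Fin N → Fin N → Prop}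
      {W : ℕ → Matrix (Fin N) (Fin N) ℝ} {f : Fin N → ℕ → Vec d → ℝ} {x c : ℕ → Fin N → Vec d},
      1 ≤ T → NetworkAssumption w B edge W →
      BoundedTrajectory T L BX Bg W (stepSize a b κ) (clipLevel Bg α) f x c →
      nreg f x T ≤ C * (T : ℝ) ^ κ * (1 + variation f T)
        + 2 * N ^ 2 * ∑ t ∈ Finset.Ico 1 T, clipError f t (x t) (c t) := by
  obtain ⟨S, hS, hdisagreement⟩ := exists_sum_disagreement_le (L := L) (B := B) hN hBX hBg hw ha
    hab hκ hκ1 hακ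
  have hκ0 : 0 < κ := by linarith
  set H := 4 * Bg ^ 2 * (min a (a + b)) ^ (-κ)
  set Θ := (a + |b|) ^ κ
  set K := N * Bg * (2 * BX) + N * L * (2 * BX) ^ 2
  set R := 2 * N ^ 3 * Bg * L + 4 * N * (N * L) ^ 2 * BX
  refine ⟨2 * N ^ 2 * (Θ * (2 * K + 3) + N * L * (H / κ)) + R * S + 2 * N * (N * Bg) ^ 2,
    by positivity, ?_⟩
  intro d T edge W f x c hT hW h
  set P := (T : ℝ) ^ κ
  set Q := 1 + variation f T
  have hP : 1 ≤ P := Real.one_le_rpow (by exact_mod_cast hT) hκ0.le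
  have hD : 0 ≤ variation f T := variation_nonneg
  have hPQ : P ≤ P * Q := le_mul_of_one_le_right (by linarith) (by linarith)
  have hvariation : (stepSize a b κ T)⁻¹ * (2 * K + 3 * variation f T)
      ≤ Θ * P * ((2 * K + 3) * Q) :=
    mul_le_mul (inv_stepSize_le ha hab hκ0.le hT) (by nlinarith [show 0 ≤ K by positivity])
      (by positivity) (by positivity)
  have hsecond : ∑ t ∈ Finset.Ico 1 T, stepSize a b κ t * clipLevel Bg α t ^ 2
      ≤ H / κ * (P * Q) :=
    (sum_Ico_le_of_le_rpow hκ0 hκ1 (by positivity) T fun t ht =>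
      stepSize_mul_clipLevel_sq_le ha hab hκ0.le hακ ht).trans (by gcongr)
  have hconsensus : ∑ t ∈ Finset.Icc 1 T, disagreement (x t) ≤ S * (P * Q) :=
    (hdisagreement hT hW h).trans (by gcongr)
  have hlast : 2 * N * (N * Bg) ^ 2 ≤ 2 * N * (N * Bg) ^ 2 * (P * Q) :=
    le_mul_of_one_le_right (by positivity) (hP.trans hPQ)
  set E := ∑ t ∈ Finset.Ico 1 T, clipError f t (x t) (c t)
  calc nreg f x T ≤ 2 * N ^ 2 * (E + Θ * P * ((2 * K + 3) * Q) + N * L * (H / κ * (P * Q)))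
        + R * (S * (P * Q)) + 2 * N * (N * Bg) ^ 2 * (P * Q) :=
        (h.nreg_le hN hBX hBg hT).trans (by gcongr)
    _ = _ := by ring

theorem exists_measure_sum_clipError_ge_le (hN : 1 ≤ N) (hp : 1 ≤ p) (hσ : 0 ≤ σ) (hBg : 0 < Bg)
    (hκ : 0 < κ) (hκ1 : κ ≤ 1) (hα : 0 ≤ α) (hακ : 2 * α = 2 * κ - 1)
    (hαp : α * (1 - p) = κ - 1) :
    ∃ C : ℝ, 0 < C ∧ ∀ {d T : ℕ} {Ω : Type*} [MeasurableSpace Ω] {μ : Measure Ω}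
      [IsProbabilityMeasure μ] {W : ℕ → Matrix (Fin N) (Fin N) ℝ} {η : ℕ → ℝ}
      {f : Fin N → ℕ → Vec d → ℝ} {x₁ : Fin N → Ω → Vec d} {X : ℕ → Fin N → Ω → Vec d}
      {G : Fin N → ℕ → Ω → Vec d} {δ : ℝ},
      1 ≤ T → 0 < δ → δ ≤ 1 →
      ClippedDescent μ T L p σ BX Bg W η (clipLevel Bg α) f x₁ X G →
      μ.real {ω | C * (T : ℝ) ^ κ * (1 + Real.log (1 / δ)) ≤ ∑ t ∈ Finset.Ico 1 T,
        clipError f t (fun i => X t i ω) fun i => clip (clipLevel Bg α t) (G i t ω)} ≤ δ := by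
  set A := N * Bg * Bg ^ (1 - p) * σ ^ p
  set M := N * Bg * (3 * Bg)
  refine ⟨A / κ + M, by positivity, ?_⟩
  intro d T Ω _ μ _ W η f x₁ X G δ hT hδ hδ1 h
  have hT1 : (1 : ℝ) ≤ T := by exact_mod_cast hT
  set P := (T : ℝ) ^ κ
  set ℓ := Real.log (1 / δ) with hℓ
  have hℓ0 : 0 ≤ ℓ := Real.log_nonneg (one_le_one_div hδ hδ1)
  have hMP : 0 < M * P := by positivity
  have hrange : ∀ t ∈ Finset.Ico 1 T, (M * P)⁻¹ * (N * Bg * (Bg + clipLevel Bg α t)) ≤ 1 := by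
    intro t ht
    have ht' := Finset.mem_Ico.1 ht
    rw [inv_mul_le_one₀ hMP]
    calc N * Bg * (Bg + clipLevel Bg α t) ≤ N * Bg * (3 * Bg * P) := by
          gcongr
          exact (add_clipLevel_le_of_le hBg.le hα ht'.1 ht'.2.le).trans (by
            gcongr
            exact Real.rpow_le_rpow_of_exponent_le hT1 (by linarith))
      _ = M * P := (mul_assoc _ _ _).symm
  have hbias : ∑ t ∈ Finset.Ico 1 T, N * Bg * (clipLevel Bg α t / 2) ^ (1 - p) * σ ^ p
      ≤ A / κ * P := sum_Ico_le_of_le_rpow hκ hκ1 (by positivity) T fun t _ => by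
    rw [half_clipLevel_rpow hBg.le, hαp]
    exact (by ring : _ = _).le
  have hsquare : (M * P)⁻¹ * ∑ t ∈ Finset.Ico 1 T, (N * Bg * (Bg + clipLevel Bg α t)) ^ 2
      ≤ M * P := by
    rw [inv_mul_le_iff₀ hMP, ← sq]
    exact sum_sq_mul_add_clipLevel_le hBg.le hα hακ (by positivity) hT
  have hdrift := h.boundedDrift_clipError hp hσ hBg fun t ht => two_mul_le_clipLevel hBg.le hα ht
  refine (measureReal_mono fun ω hω => ?_).trans
    (hdrift.measure_sum_ge_le hT (inv_pos.2 hMP) hrange hδ)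
  refine le_trans ?_ (Set.mem_ofPred_eq ▸ hω)
  rw [← hℓ, div_inv_eq_mul]
  nlinarith [mul_nonneg (show 0 ≤ A / κ * P by positivity) hℓ0]

theorem ofReal_one_sub_le_measure {Ω : Type*} [MeasurableSpace Ω] {μ : Measure Ω}
    [IsProbabilityMeasure μ] {s t : Set Ω} {δ : ℝ} (hs : μ.real s ≤ δ)
    (ht : ∀ᵐ ω ∂μ, ω ∉ s → ω ∈ t) : ENNReal.ofReal (1 - δ) ≤ μ t := by
  have hs' : μ s ≤ ENNReal.ofReal δ := ofReal_measureReal (μ := μ) (s := s) ▸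
    ENNReal.ofReal_le_ofReal hs
  have hcover : (1 : ENNReal) ≤ μ s + μ sᶜ := by
    rw [← measure_univ (μ := μ), ← Set.union_compl_self s]
    exact measure_union_le _ _
  rw [ENNReal.ofReal_sub _ (measureReal_nonneg.trans hs), ENNReal.ofReal_one]
  exact tsub_le_iff_left.2 (hcover.trans (add_le_add hs' (measure_mono_ae ht)))

end Assembly

end ODCSGD

end

theorem corollary2_general (N : ℕ) (hN : 1 ≤ N)
    (p : ℝ) (hp : 1 ≤ p) (σ : ℝ) (hσ : 0 ≤ σ) (L : ℝ≥0)
    (BX Bg : ℝ) (hBX : 0 ≤ BX) (hBg : 0 < Bg)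
    (w : ℝ) (hw : 0 < w) (B : ℕ)
    (a b : ℝ) (ha : 0 < a) (hab : 0 < a + b) :
    ∃ C : ℝ, 0 < C ∧
      ∀ (d : ℕ) (Ω : Type*) [MeasurableSpace Ω] (μ : Measure Ω) [IsProbabilityMeasure μ]
        (edge : ℕ → Fin N → Fin N → Prop) (W : ℕ → Matrix (Fin N) (Fin N) ℝ)
        (f : Fin N → ℕ → ODCSGD.Vec d → ℝ)
        (x₁ : Fin N → Ω → ODCSGD.Vec d)
        (g : Fin N → ℕ → Ω → ODCSGD.Vec d → ODCSGD.Vec d)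
        (X : ℕ → Fin N → Ω → ODCSGD.Vec d) (G : Fin N → ℕ → Ω → ODCSGD.Vec d)
        (T : ℕ) (δ : ℝ),
        X = ODCSGD.randomStates W (ODCSGD.stepSize a b ((p + 1) / (2 * p)))
              (ODCSGD.clipLevel Bg (1 / (2 * p))) x₁ g →
        G = ODCSGD.observed g X →
        1 ≤ T → 0 < δ → δ < 1 →
        ODCSGD.NetworkAssumption w B edge W →
        (∀ i, Measurable (x₁ i)) →
        (∀ i, ∀ t ∈ Finset.Icc 1 T, Measurable (G i t)) →
        (∀ i, ∀ t ∈ Finset.Icc 1 T, ODCSGD.LSmooth L (f i t)) →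
        ODCSGD.Unbiased μ T f x₁ X G →
        ODCSGD.HeavyTailed μ T p σ f x₁ X G →
        ODCSGD.BoundedStates μ T BX Bg f X →
        ODCSGD.FiniteVariation f T →
        ENNReal.ofReal (1 - δ) ≤
          μ {ω | ODCSGD.nreg f (fun t i => X t i ω) T ≤
            C * (T : ℝ) ^ ((1 + p) / (2 * p)) *
              (1 + ODCSGD.variation f T + Real.log (1 / δ))} := by
  rw [add_comm 1 p]
  set κ := (p + 1) / (2 * p) with hκ
  set α := 1 / (2 * p) with hα
  have hκ2 : 1 / 2 ≤ κ := by rw [hκ, div_le_div_iff₀ (by norm_num) (by positivity)]; linarith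
  have hκ1 : κ ≤ 1 := by rw [hκ, div_le_one (by positivity)]; linarith
  have hακ : 2 * α = 2 * κ - 1 := by rw [hκ, hα]; field_simp; ring
  have hαp : α * (1 - p) = κ - 1 := by rw [hκ, hα]; field_simp; ring
  obtain ⟨C₁, hC₁, hregret⟩ :=
    ODCSGD.exists_nreg_le (L := L) (B := B) hN hBX hBg.le hw ha hab hκ2 hκ1 hακ
  obtain ⟨C₂, hC₂, htail⟩ := ODCSGD.exists_measure_sum_clipError_ge_le (L := L) (BX := BX) hN hp hσ
    hBg (by linarith) hκ1 (by positivity) hακ hαp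
  refine ⟨C₁ + 2 * N ^ 2 * C₂, by positivity, ?_⟩
  intro d Ω _ μ _ edge W f x₁ g X G T δ hX hG hT hδ hδ1 hW hx₁ hGm hf hunb hheavy hbdd hfin
  have hdescent : ODCSGD.ClippedDescent μ T L p σ BX Bg W (ODCSGD.stepSize a b κ)
      (ODCSGD.clipLevel Bg α) f x₁ X G :=
    ⟨by rw [hX]; rfl, fun t ht => ODCSGD.randomStates_succ hX hG ht, hx₁, hGm, hf, hunb, hheavy,
      hbdd⟩
  refine ODCSGD.ofReal_one_sub_le_measure (htail hT hδ hδ1.le hdescent) ?_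
  filter_upwards [hdescent.ae_boundedTrajectory hW.col_sum
    (fun t ht => ODCSGD.stepSize_pos ha hab ht)
    (ODCSGD.inv_stepSize_monotoneOn ha hab (by linarith)) (ODCSGD.clipLevel_nonneg hBg.le) hfin]
    with ω hω hsmall
  have hlog : 1 + ODCSGD.variation f T ≤ 1 + ODCSGD.variation f T + Real.log (1 / δ) :=
    le_add_of_nonneg_right (Real.log_nonneg (one_le_one_div hδ hδ1.le))
  have hvariation : 1 + Real.log (1 / δ) ≤ 1 + ODCSGD.variation f T + Real.log (1 / δ) := by
    linarith [ODCSGD.variation_nonneg (f := f) (T := T)]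
  calc ODCSGD.nreg f (fun t i => X t i ω) T
      ≤ C₁ * (T : ℝ) ^ κ * (1 + ODCSGD.variation f T)
        + 2 * N ^ 2 * (C₂ * (T : ℝ) ^ κ * (1 + Real.log (1 / δ))) :=
        (hregret hT hW hω).trans (by gcongr; exact (not_le.1 hsmall).le)
    _ ≤ C₁ * (T : ℝ) ^ κ * (1 + ODCSGD.variation f T + Real.log (1 / δ))
        + 2 * N ^ 2 * (C₂ * (T : ℝ) ^ κ * (1 + ODCSGD.variation f T + Real.log (1 / δ))) := by
        gcongr
    _ = _ := by ring

theorem corollary2 (N : ℕ) (hN : 1 ≤ N)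
    (p : ℝ) (hp : 1 < p ∧ p ≤ 2) (σ : ℝ) (hσ : 0 < σ) (L : ℝ≥0)
    (BX Bg : ℝ) (hBX : 0 < BX) (hBg : 0 < Bg)
    (w : ℝ) (hw : 0 < w ∧ w < 1) (B : ℕ) (hB : 1 ≤ B)
    (a b : ℝ) (ha : 0 < a) (hab : 0 < a + b) :
    ∃ C : ℝ, 0 < C ∧
      ∀ (d : ℕ) (Ω : Type*) [MeasurableSpace Ω] (μ : Measure Ω) [IsProbabilityMeasure μ]
        (edge : ℕ → Fin N → Fin N → Prop) (W : ℕ → Matrix (Fin N) (Fin N) ℝ)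
        (f : Fin N → ℕ → ODCSGD.Vec d → ℝ)
        (x₁ : Fin N → Ω → ODCSGD.Vec d)
        (g : Fin N → ℕ → Ω → ODCSGD.Vec d → ODCSGD.Vec d)
        (X : ℕ → Fin N → Ω → ODCSGD.Vec d) (G : Fin N → ℕ → Ω → ODCSGD.Vec d)
        (T : ℕ) (δ : ℝ),
        X = ODCSGD.randomStates W (ODCSGD.stepSize a b ((p + 1) / (2 * p)))
              (ODCSGD.clipLevel Bg (1 / (2 * p))) x₁ g →
        G = ODCSGD.observed g X →
        1 ≤ T → 0 < δ → δ < 1 →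
        ODCSGD.NetworkAssumption w B edge W →
        (∀ i, Measurable (x₁ i)) →
        (∀ i, ∀ t ∈ Finset.Icc 1 T, Measurable (G i t)) →
        (∀ i, ∀ t ∈ Finset.Icc 1 T, ODCSGD.LSmooth L (f i t)) →
        ODCSGD.Unbiased μ T f x₁ X G →
        ODCSGD.HeavyTailed μ T p σ f x₁ X G →
        ODCSGD.BoundedStates μ T BX Bg f X →
        ODCSGD.FiniteVariation f T →
        ENNReal.ofReal (1 - δ) ≤
          μ {ω | ODCSGD.nreg f (fun t i => X t i ω) T ≤
            C * (T : ℝ) ^ ((1 + p) / (2 * p)) *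
              (1 + ODCSGD.variation f T + Real.log (1 / δ))} :=
  corollary2_general N hN p hp.1.le σ hσ.le L BX Bg hBX.le hBg w hw.1 B a b ha hab
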